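/- There are universal constants $C,\varepsilon>0$ such that the following holds. Let $S\subset\mathbb{R}^3$ be a compact smooth embedded surface without boundary, with a continuous unit normal field $\vec n_S$ (for instance the outer normal), area $a(S)$, and greatest principal curvature in absolute value $\kappa_S$. Let $u:\mathbb{R}^3\times\mathbb{S}^2\to\mathbb{R}$ be bounded, with $\|u\|_\infty=\sup|u|$, and $k_u$-Lipschitz, i.e. $|u(x,m)-u(y,n)|\le k_u(|x-y|+|m-n|)$. Put $\mu_S(u)=\int_S u(x,\vec n_S(x))\,d\sigma(x)$, where $\sigma$ is the area measure of $S$. Let $X$ be a triangular mesh inscribed in $S$: its vertices lie on $S$, every point $x$ of its (full) triangles has a unique closest point $\xi(x)$ on $S$, $\xi$ is a bijection from the union of the triangles onto $S$, and the unit normal $\vec n_f$ of each face $f$, with center $c(f)$, is the one with $\langle \vec n_f,\vec n_S(\xi(c(f)))\rangle>0$. Let $\eta_X$ be its greatest edge length, $\theta_X$ the smallest angle of its faces, and $\mu_X(u)=\sum_f a(f)\,u(c(f),\vec n_f)$, where $a(f)$ is the area of $f$. If the edges are small in the sense that $\kappa_S\,\eta_X\le\varepsilon\sin\theta_X$, then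 $$|\mu_S(u)-\mu_X(u)|\le C\,a(S)\,\frac{\kappa_S+1}{\sin\theta_X}\,(k_u+\|u\|_\infty)\,\eta_X .$$ Consequently, for any two such meshes $X,\hat X$ inscribed in the same $S$, $$|\mu_X(u)-\mu_{\hat X}(u)|\le C\,a(S)\,(\kappa_S+1)\,(k_u+\|u\|_\infty)\Big(\frac{\eta_X}{\sin\theta_X}+\frac{\eta_{\hat X}}{\sin\theta_{\hat X}}\Big).$$ -/

import Mathlib

open MeasureTheory Filter Topology
open scoped ContDiff RealInnerProductSpace

noncomputable section

namespace MeshVarifold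

/-- Euclidean three-space. -/
abbrev E3 : Type := EuclideanSpace ℝ (Fin 3)

/-- The unit sphere of `E3`, with the chordal distance. -/
abbrev S2 : Type := Metric.sphere (0 : E3) 1

/-! ### Smooth surfaces -/

/-- A smooth surface without boundary, embedded in `E3`: near each of its points it is the zero set
of a smooth function whose differential at the point does not vanish. -/
def IsSmoothSurface (S : Set E3) : Prop :=
  ∀ x ∈ S, ∃ U : Set E3, IsOpen U ∧ x ∈ U ∧ ∃ g : E3 → ℝ,
    ContDiffOn ℝ ∞ g U ∧ fderiv ℝ g x ≠ 0 ∧ S ∩ U = {y ∈ U | g y = 0}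

/-- `v` is tangent to `S` at `x`: it is the velocity at `x` of a curve drawn on `S`. -/
def IsTangentVector (S : Set E3) (x v : E3) : Prop :=
  ∃ γ : ℝ → E3, γ 0 = x ∧ (∀ᶠ t in 𝓝 (0 : ℝ), γ t ∈ S) ∧ HasDerivAt γ v 0

/-- `n` restricts to a continuous unit normal vector field along `S` (its values outside `S` play
no role). -/
def IsUnitNormalField (S : Set E3) (n : E3 → S2) : Prop :=
  ContinuousOn n S ∧ ∀ x ∈ S, ∀ v : E3, IsTangentVector S x v → ⟪(n x : E3), v⟫ = 0

/-- `c` is a principal curvature of `S` at `x`: an eigenvalue of the shape operator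
`v ↦ -dn(x) v` on the tangent plane, where `dn(x)` is the differential of `n` along `S`. -/
def IsPrincipalCurvature (S : Set E3) (n : E3 → S2) (x : E3) (c : ℝ) : Prop :=
  ∃ A : E3 →L[ℝ] E3, HasFDerivWithinAt (fun y => (n y : E3)) A S x ∧
    ∃ v : E3, IsTangentVector S x v ∧ v ≠ 0 ∧ -(A v) = c • v

/-- `κ_S`: the greatest absolute value of a principal curvature over `S`. -/
def maxCurvature (S : Set E3) (n : E3 → S2) : ℝ :=
  sSup {r : ℝ | ∃ x ∈ S, ∃ c : ℝ, IsPrincipalCurvature S n x c ∧ r = |c|}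

/-- `a(A)`: the area of `A`, i.e. its two-dimensional Hausdorff measure, normalized so that it is
Lebesgue measure on planes. -/
def area (A : Set E3) : ℝ := (μHE[2] A).toReal

/-- The varifold `μ_S`: the image of the area measure of `S` under `x ↦ (x, n x)`. -/
def surfaceVarifold (S : Set E3) (n : E3 → S2) : Measure (E3 × S2) :=
  Measure.map (fun x => (x, n x)) (μHE[2].restrict S)

/-! ### Triangular meshes -/

/-- A triangular mesh in `E3`. A face is given by the set of its three vertices; faces are not
degenerate, two of them meet at most along a common edge or vertex, and each face is equipped with
one of its two unit normals. -/
structure TriMesh where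
  faces : Finset (Finset E3)
  card_eq : ∀ f ∈ faces, f.card = 3
  indep : ∀ f ∈ faces, AffineIndependent ℝ ((↑) : f → E3)
  inter_subset : ∀ f ∈ faces, ∀ g ∈ faces,
    convexHull ℝ (f : Set E3) ∩ convexHull ℝ (g : Set E3) ⊆ convexHull ℝ ((f : Set E3) ∩ (g : Set E3))
  normal : Finset E3 → S2
  normal_orthogonal : ∀ f ∈ faces, ∀ p ∈ f, ∀ q ∈ f, ⟪(normal f : E3), q - p⟫ = 0

/-- The center `c(f)` of a triangle. -/
def center (f : Finset E3) : E3 := (3 : ℝ)⁻¹ • ∑ p ∈ f, p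

namespace TriMesh

/-- The union of the full triangles of the mesh. -/
def space (X : TriMesh) : Set E3 := ⋃ f ∈ X.faces, convexHull ℝ (f : Set E3)

/-- `η_X`: the greatest edge length. -/
def maxEdge (X : TriMesh) : ℝ :=
  sSup {r : ℝ | ∃ f ∈ X.faces, ∃ p ∈ f, ∃ q ∈ f, r = dist p q}

/-- `θ_X`: the smallest angle among all faces. -/
def minAngle (X : TriMesh) : ℝ :=
  sInf {r : ℝ | ∃ f ∈ X.faces, ∃ p ∈ f, ∃ q ∈ f, ∃ s ∈ f, p ≠ q ∧ q ≠ s ∧ p ≠ s ∧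
    r = EuclideanGeometry.angle p q s}

/-- The discrete varifold `μ_X`: the sum over the faces `f` of Dirac masses at
`(c(f), n_f)` with weight the area of `f`. -/
def varifold (X : TriMesh) : Measure (E3 × S2) :=
  ∑ f ∈ X.faces, μHE[2] (convexHull ℝ (f : Set E3)) • Measure.dirac (center f, X.normal f)

end TriMesh

/-- `y` is a closest point of `S` to `x`. -/
def IsClosestPoint (S : Set E3) (x y : E3) : Prop :=
  y ∈ S ∧ ∀ z ∈ S, dist x y ≤ dist x z

/-- The mesh `X` is inscribed in the surface `S` oriented by `n`: its vertices are on `S`; every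
point of its triangles has a unique closest point `ξ x` on `S`, and `ξ` is a bijection from the
union of the triangles onto `S`; the normal of each face is on the same side as the normal of `S`
at the projection of the center of the face. -/
def IsInscribed (S : Set E3) (n : E3 → S2) (X : TriMesh) : Prop :=
  (∀ f ∈ X.faces, ∀ p ∈ f, p ∈ S) ∧
  ∃ ξ : E3 → E3,
    (∀ x ∈ X.space, ∀ y, IsClosestPoint S x y ↔ y = ξ x) ∧
    Set.BijOn ξ X.space S ∧
    ∀ f ∈ X.faces, 0 < ⟪(X.normal f : E3), (n (ξ (center f)) : E3)⟫

/-- `u` is `k`-Lipschitz for the sum of the distances of the two factors. -/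
def IsLip (u : E3 × S2 → ℝ) (k : ℝ) : Prop :=
  ∀ (x y : E3) (m n : S2), |u (x, m) - u (y, n)| ≤ k * (dist x y + dist m n)

/-- `‖u‖_∞`, the supremum of `|u|`. -/
def supNorm (u : E3 × S2 → ℝ) : ℝ := ⨆ z, |u z|

end MeshVarifold

end

open MeshVarifold

/-! The integrals are compared face by face, with ρ = κη / sin θ as the small parameter.

Curvature enters through `norm_fderiv_normal_le`: the differential of the normal is symmetric on the
tangent plane, so its norm there is at most κ. On a face, the closest-point projection ξ is
therefore 2-Lipschitz and n ∘ ξ is 2κ-Lipschitz. Hence an edge is orthogonal to the surface normal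
at one of its ends up to a relative error 4κη (`IsNearProjection.abs_inner_normal_sub_le`). Two
edges whose angle has sine at least sin θ determine the face normal up to sign
(`one_sub_inner_sq_le`), and the orientation at the center fixes the sign: n ∘ ξ stays within 15ρ of
the face normal (`TriMesh.norm_normal_sub_le`).

The height over S then varies slowly along the face, so ξ is an isometry up to 30ρ
(`IsNearProjection.norm_sub_sub_sub_le`) and changes the area by a relative error at most 150ρ
(`abs_measure_image_sub_le`). The images of the faces tile S up to null sets
(`TriMesh.restrict_eq_sum`). Summing, a face costs its projected area times k(2η + 15ρ), for moving
the argument of u, plus 150ρ‖u‖, for the change of area.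

The map ξ is never differentiated. Each estimate is proved infinitesimally, with an arbitrarily
small loss where needed, and then integrated along segments by `norm_image_sub_le_of_eventually`. -/

namespace MeshVarifold

/-! ### Tangent vectors and normals of a level set -/

section

variable {S U : Set E3} {n : E3 → S2} {g : E3 → ℝ} {x y : E3}

lemma two_le_infty : (2 : WithTop ℕ∞) ≤ ∞ := by
  exact WithTop.coe_le_coe.2 le_top

lemma norm_coe_S2 (m : S2) : ‖(m : E3)‖ = 1 := by simp

lemma inner_self_S2 (m : S2) : ⟪(m : E3), (m : E3)⟫ = 1 := by
  rw [real_inner_self_eq_norm_sq, norm_coe_S2]; norm_num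

lemma norm_sub_inner_smul_le (m : S2) (v : E3) : ‖v - ⟪(m : E3), v⟫ • (m : E3)‖ ≤ ‖v‖ := by
  refine le_of_sq_le_sq ?_ (norm_nonneg _)
  rw [norm_sub_sq_real, inner_smul_right, norm_smul, norm_coe_S2, Real.norm_eq_abs, mul_one,
    sq_abs, real_inner_comm (m : E3) v]
  nlinarith [sq_nonneg ⟪(m : E3), v⟫]

lemma inner_gradient (g : E3 → ℝ) (y v : E3) : ⟪gradient g y, v⟫ = fderiv ℝ g y v := by
  simp [gradient]

/-- The implicit function theorem parametrizes the level set by the kernel of the differential; the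
image of the line spanned by `v` is the required curve. -/
lemma isTangentVector_of_fderiv_eq_zero (hU : IsOpen U) (hg : ContDiffOn ℝ ∞ g U)
    (hS : S ∩ U = {y ∈ U | g y = 0}) (hy : y ∈ S) (hyU : y ∈ U) (hd : fderiv ℝ g y ≠ 0)
    {v : E3} (hv : fderiv ℝ g y v = 0) : IsTangentVector S y v := by
  have hgy : g y = 0 := (hS.subset ⟨hy, hyU⟩).2
  have hs : HasStrictFDerivAt g (fderiv ℝ g y) y :=
    (hg.contDiffAt (hU.mem_nhds hyU)).hasStrictFDerivAt (by simp)
  have hr : (fderiv ℝ g y : E3 →ₗ[ℝ] ℝ).range = ⊤ := by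
    apply LinearMap.range_eq_top.2
    apply LinearMap.surjective
    intro h
    apply hd
    ext w
    exact LinearMap.congr_fun h w
  let ψ := hs.implicitFunction g (fderiv ℝ g y) hr
  let v' : (fderiv ℝ g y : E3 →ₗ[ℝ] ℝ).ker := ⟨v, hv⟩
  have hψ : HasFDerivAt (ψ (g y)) (fderiv ℝ g y : E3 →ₗ[ℝ] ℝ).ker.subtypeL 0 :=
    (hs.to_implicitFunction hr).hasFDerivAt
  have hlin : HasDerivAt (fun t : ℝ => t • v') v' 0 := by
    simpa using (hasDerivAt_id (0 : ℝ)).smul_const v'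
  have hγ : HasDerivAt (fun t : ℝ => ψ (g y) (t • v')) v 0 := by
    have h0 : HasFDerivAt (ψ (g y)) (fderiv ℝ g y : E3 →ₗ[ℝ] ℝ).ker.subtypeL ((0 : ℝ) • v') := by
      simpa using hψ
    exact h0.comp_hasDerivAt (0 : ℝ) hlin
  have hψ0 : ψ (g y) 0 = y := by
    exact hs.implicitFunction_apply_image hr
  have h0 : ψ (g y) ((0 : ℝ) • v') = y := by simpa using hψ0
  refine ⟨fun t => ψ (g y) (t • v'), h0, ?_, hγ⟩
  have hev : ∀ᶠ t : ℝ in 𝓝 0, g (ψ (g y) (t • v')) = g y := by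
    have hc : Tendsto (fun t : ℝ => (g y, t • v')) (𝓝 0) (𝓝 (g y, 0)) := by
      have : Continuous (fun t : ℝ => (g y, t • v')) := by fun_prop
      simpa using this.tendsto 0
    exact hc.eventually (hs.map_implicitFunction_eq hr)
  have hevU : ∀ᶠ t : ℝ in 𝓝 0, ψ (g y) (t • v') ∈ U := by
    have := hγ.continuousAt.tendsto
    rw [h0] at this
    exact this (hU.mem_nhds hyU)
  filter_upwards [hev, hevU] with t h1 h2
  exact (hS.superset ⟨h2, h1.trans hgy⟩).1

/-- The component of the normal orthogonal to the gradient is a tangent vector, so it is orthogonal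
to the normal and hence to itself. -/
lemma coe_normal_eq_smul_gradient (hn : IsUnitNormalField S n) (hU : IsOpen U)
    (hg : ContDiffOn ℝ ∞ g U) (hS : S ∩ U = {y ∈ U | g y = 0}) (hy : y ∈ S) (hyU : y ∈ U)
    (hd : fderiv ℝ g y ≠ 0) :
    (n y : E3) = (⟪(n y : E3), gradient g y⟫ / ‖gradient g y‖ ^ 2) • gradient g y := by
  have hG : ‖gradient g y‖ ≠ 0 := by
    rw [norm_ne_zero_iff]
    simpa [gradient] using hd
  set G := gradient g y with hGdef
  set c := ⟪(n y : E3), G⟫ / ‖G‖ ^ 2 with hc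
  have hGv : ⟪G, (n y : E3) - c • G⟫ = 0 := by
    rw [inner_sub_right, inner_smul_right, real_inner_self_eq_norm_sq, real_inner_comm, hc]
    field_simp
    ring
  have ht := isTangentVector_of_fderiv_eq_zero hU hg hS hy hyU hd
    (v := (n y : E3) - c • G) (by rw [← inner_gradient, ← hGdef, hGv])
  have h1 := hn.2 y hy _ ht
  have h2 : ⟪(n y : E3) - c • G, (n y : E3) - c • G⟫ = 0 := by
    rw [inner_sub_left, h1, inner_smul_left, hGv]; simp
  exact sub_eq_zero.1 (inner_self_eq_zero.1 h2)

lemma isTangentVector_of_inner_eq_zero (hsm : IsSmoothSurface S) (hn : IsUnitNormalField S n)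
    (hx : x ∈ S) {v : E3} (hv : ⟪(n x : E3), v⟫ = 0) : IsTangentVector S x v := by
  obtain ⟨U, hU, hxU, g, hg, hd, hS⟩ := hsm x hx
  have h := coe_normal_eq_smul_gradient hn hU hg hS hx hxU hd
  refine isTangentVector_of_fderiv_eq_zero hU hg hS hx hxU hd ?_
  rw [h, inner_smul_left, inner_gradient] at hv
  rcases mul_eq_zero.1 hv with h0 | h0
  · simp only [conj_trivial] at h0
    rw [h0, zero_smul] at h
    have := norm_coe_S2 (n x)
    rw [h] at this
    simp at this
  · exact h0

lemma isLittleO_inner_normal (hsm : IsSmoothSurface S) (hn : IsUnitNormalField S n) (hx : x ∈ S) :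
    (fun y => ⟪(n x : E3), y - x⟫) =o[𝓝[S] x] fun y => y - x := by
  obtain ⟨U, hU, hxU, g, hg, hd, hS⟩ := hsm x hx
  have h := coe_normal_eq_smul_gradient hn hU hg hS hx hxU hd
  have hdiff : HasFDerivAt g (fderiv ℝ g x) x :=
    ((hg.contDiffAt (hU.mem_nhds hxU)).differentiableAt (by simp)).hasFDerivAt
  have ho := (hdiff.isLittleO.mono (nhdsWithin_le_nhds (s := S))).const_mul_left
    (-(⟪(n x : E3), gradient g x⟫ / ‖gradient g x‖ ^ 2))
  refine ho.congr' ?_ EventuallyEq.rfl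
  filter_upwards [self_mem_nhdsWithin, mem_nhdsWithin_of_mem_nhds (hU.mem_nhds hxU)] with y hy hyU
  have h1 : g y = 0 := (hS.subset ⟨hy, hyU⟩).2
  have h2 : g x = 0 := (hS.subset ⟨hx, hxU⟩).2
  conv_rhs => rw [h, inner_smul_left, inner_gradient]
  rw [h1, h2, map_sub]
  simp only [conj_trivial]
  ring

/-- The extension is ± the normalized gradient of a defining function. Its differential is a
multiple of the Hessian plus a term along the gradient; the latter vanishes against tangent vectors,
and the former is symmetric. -/
lemma exists_smooth_extension_normal (hsm : IsSmoothSurface S) (hn : IsUnitNormalField S n)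
    (hx : x ∈ S) : ∃ F : E3 → E3, ContDiffAt ℝ 1 F x ∧ (∀ᶠ y in 𝓝[S] x, (n y : E3) = F y) ∧
      ∀ v w : E3, ⟪(n x : E3), v⟫ = 0 → ⟪(n x : E3), w⟫ = 0 →
        ⟪fderiv ℝ F x v, w⟫ = ⟪fderiv ℝ F x w, v⟫ := by
  obtain ⟨U, hU, hxU, g, hg, hd, hS⟩ := hsm x hx
  have hgx := hg.contDiffAt (hU.mem_nhds hxU)
  have hfd : ContDiffAt ℝ 1 (fderiv ℝ g) x := hgx.fderiv_right (by simpa [one_add_one_eq_two] using two_le_infty)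
  have hG : ContDiffAt ℝ 1 (gradient g) x :=
    (InnerProductSpace.toDual ℝ E3).symm.toContinuousLinearEquiv.toContinuousLinearMap.contDiff.contDiffAt.comp
      x hfd
  have hGx : gradient g x ≠ 0 := by simpa [gradient] using hd
  -- This is the sign relating the normal to the gradient: ±1 on S near x and continuous there,
  -- hence constant near x. Freezing it at x makes `φ` smooth.
  let s : E3 → ℝ := fun y => ⟪(n y : E3), gradient g y⟫ / ‖gradient g y‖
  let φ : E3 → ℝ := fun y => s x / ‖gradient g y‖
  have hφ : ContDiffAt ℝ 1 φ x := contDiffAt_const.div (hG.norm ℝ hGx) (by simpa using hGx)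
  have hne : ∀ᶠ y in 𝓝[S] x, fderiv ℝ g y ≠ 0 :=
    nhdsWithin_le_nhds (hfd.continuousAt.eventually_ne hd)
  have hsc : ContinuousWithinAt s S x := by
    refine ContinuousWithinAt.div ?_ ?_ (by simpa using hGx)
    · exact (continuous_subtype_val.continuousAt.comp_continuousWithinAt (hn.1 x hx)).inner
        hG.continuousAt.continuousWithinAt
    · exact hG.continuousAt.continuousWithinAt.norm
  have hnear : ∀ᶠ y in 𝓝[S] x, |s y - s x| < 1 := by
    have := hsc.eventually (Metric.ball_mem_nhds (s x) one_pos)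
    simpa [Real.dist_eq] using this
  have hnU : ∀ᶠ y in 𝓝[S] x, (n y : E3) = (s y / ‖gradient g y‖) • gradient g y ∧ s y ^ 2 = 1 := by
    filter_upwards [hne, self_mem_nhdsWithin, mem_nhdsWithin_of_mem_nhds (hU.mem_nhds hxU)]
      with y h1 h2 h3
    have h := coe_normal_eq_smul_gradient hn hU hg hS h2 h3 h1
    have hpos : ‖gradient g y‖ ≠ 0 := by simpa [gradient] using h1
    have h' : (n y : E3) = (s y / ‖gradient g y‖) • gradient g y := by
      refine h.trans ?_; congr 1; simp only [s]; field_simp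
    refine ⟨h', ?_⟩
    have hnn := congrArg (fun z : E3 => ‖z‖ ^ 2) h'
    simp only [norm_coe_S2, norm_smul, norm_div, norm_norm] at hnn
    rw [div_mul_cancel₀ _ hpos] at hnn
    rw [← sq_abs, ← Real.norm_eq_abs, ← hnn]; norm_num
  have hsx : s x ^ 2 = 1 := (hnU.self_of_nhdsWithin hx).2
  refine ⟨fun y => φ y • gradient g y, hφ.smul hG, ?_, ?_⟩
  · filter_upwards [hnU, hnear] with y h1 h2
    have : s y = s x := by
      have h3 : (s y - s x) * (s y + s x) = 0 := by linear_combination h1.2 - hsx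
      rcases mul_eq_zero.1 h3 with h | h
      · linarith
      · exfalso
        have : s y = - s x := by linarith
        rw [this, abs_lt] at h2
        nlinarith
    rw [h1.1, this]
  · intro v w hv hw
    have hker : ∀ w : E3, ⟪(n x : E3), w⟫ = 0 → ⟪gradient g x, w⟫ = 0 := by
      intro w hw
      rw [(hnU.self_of_nhdsWithin hx).1, inner_smul_left] at hw
      rcases mul_eq_zero.1 hw with h | h
      · exfalso
        simp only [conj_trivial, div_eq_zero_iff, norm_eq_zero] at h
        rcases h with h | h
        · rw [h] at hsx; norm_num at hsx
        · exact hGx h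
      · exact h
    have hGd := (hG.differentiableAt one_ne_zero)
    have hder : fderiv ℝ (fun y => φ y • gradient g y) x =
        φ x • fderiv ℝ (gradient g) x + (fderiv ℝ φ x).smulRight (gradient g x) :=
      fderiv_fun_smul (hφ.differentiableAt one_ne_zero) hGd
    have hGder : ∀ v w : E3, ⟪fderiv ℝ (gradient g) x v, w⟫ = fderiv ℝ (fderiv ℝ g) x v w := by
      intro v w
      have h1 : HasFDerivAt (gradient g)
          ((InnerProductSpace.toDual ℝ E3).symm.toContinuousLinearEquiv.toContinuousLinearMap ∘L
            fderiv ℝ (fderiv ℝ g) x) x :=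
        (InnerProductSpace.toDual ℝ E3).symm.toContinuousLinearEquiv.toContinuousLinearMap.hasFDerivAt.comp
          x (hfd.differentiableAt one_ne_zero).hasFDerivAt
      rw [h1.fderiv]
      simp
    have hsymm : fderiv ℝ (fderiv ℝ g) x v w = fderiv ℝ (fderiv ℝ g) x w v :=
      (hgx.isSymmSndFDerivAt (by simpa using two_le_infty)).eq v w
    rw [hder]
    simp only [_root_.add_apply, _root_.smul_apply,
      ContinuousLinearMap.smulRight_apply, inner_add_left, inner_smul_left, hGder, hker w hw,
      hker v hv, hsymm, mul_zero]

end

/-! ### Curvature and the variation of the normal -/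

section

variable {S : Set E3} {n : E3 → S2} {x y : E3}

lemma hasDerivAt_normal_comp {A : E3 →L[ℝ] E3} {v : E3} {γ : ℝ → E3}
    (hA : HasFDerivWithinAt (fun y => (n y : E3)) A S x) (h0 : γ 0 = x)
    (hγS : ∀ᶠ t in 𝓝 (0 : ℝ), γ t ∈ S) (hγ : HasDerivAt γ v 0) :
    HasDerivAt (fun t => (n (γ t) : E3)) (A v) 0 := by
  subst h0
  exact hA.comp_hasDerivAt (f := γ) 0 hγ hγS

lemma norm_apply_le_of_lipschitz {A : E3 →L[ℝ] E3} {v : E3} {L : ℝ}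
    (hA : HasFDerivWithinAt (fun y => (n y : E3)) A S x) (hv : IsTangentVector S x v)
    (hL : ∀ᶠ y in 𝓝[S] x, ‖(n y : E3) - n x‖ ≤ L * ‖y - x‖) : ‖A v‖ ≤ L * ‖v‖ := by
  obtain ⟨γ, h0, hγS, hγ⟩ := hv
  have h1 := (hasDerivAt_iff_tendsto_slope.1 (hasDerivAt_normal_comp hA h0 hγS hγ)).norm
  have h2 := (hasDerivAt_iff_tendsto_slope.1 hγ).norm.const_mul L
  refine le_of_tendsto_of_tendsto h1 h2 ?_
  have hc : Tendsto γ (𝓝 0) (𝓝[S] x) := by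
    refine tendsto_nhdsWithin_iff.2 ⟨?_, hγS⟩
    have := hγ.continuousAt.tendsto
    rwa [h0] at this
  filter_upwards [nhdsWithin_le_nhds (hc.eventually hL)] with t ht
  simp only [slope, vsub_eq_sub, norm_smul, h0]
  calc _ ≤ ‖(t - 0)⁻¹‖ * (L * ‖γ t - x‖) := by gcongr
    _ = _ := by ring

/-- The real supremum of an unbounded set is 0 by convention, so `maxCurvature` dominates the
principal curvatures only once this is known. The local bound is a Lipschitz constant of the smooth
extension; compactness makes it global. -/
lemma bddAbove_principalCurvatures (hS : IsCompact S) (hsm : IsSmoothSurface S)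
    (hn : IsUnitNormalField S n) :
    BddAbove {r : ℝ | ∃ x ∈ S, ∃ c : ℝ, IsPrincipalCurvature S n x c ∧ r = |c|} := by
  suffices h : ∃ L : ℝ, ∀ x ∈ S, ∀ c, IsPrincipalCurvature S n x c → |c| ≤ L by
    obtain ⟨L, hL⟩ := h
    exact ⟨L, by rintro r ⟨x, hx, c, hc, rfl⟩; exact hL x hx c hc⟩
  refine hS.induction_on (p := fun T => ∃ L : ℝ, ∀ x ∈ T, ∀ c, IsPrincipalCurvature S n x c → |c| ≤ L)
    ⟨0, by simp⟩ ?_ ?_ ?_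
  · rintro s t hst ⟨L, hL⟩
    exact ⟨L, fun x hx => hL x (hst hx)⟩
  · rintro s t ⟨L, hL⟩ ⟨M, hM⟩
    refine ⟨max L M, fun x hx c hc => ?_⟩
    rcases hx with hx | hx
    · exact (hL x hx c hc).trans (le_max_left _ _)
    · exact (hM x hx c hc).trans (le_max_right _ _)
  · intro x hx
    obtain ⟨F, hF, hnF, -⟩ := exists_smooth_extension_normal hsm hn hx
    obtain ⟨K, t, ht, hK⟩ := hF.exists_lipschitzOnWith
    have hV : {y | (n y : E3) = F y} ∩ t ∈ 𝓝[S] x :=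
      inter_mem hnF (mem_nhdsWithin_of_mem_nhds ht)
    obtain ⟨W, hW, hxW, hWS⟩ := mem_nhdsWithin.1 hV
    refine ⟨W ∩ S, inter_mem (mem_nhdsWithin_of_mem_nhds (hW.mem_nhds hxW)) self_mem_nhdsWithin,
      K, ?_⟩
    rintro y ⟨hyW, hyS⟩ c ⟨A, hA, v, hv, hv0, hAv⟩
    have h := norm_apply_le_of_lipschitz (L := K) hA hv (by
      filter_upwards [self_mem_nhdsWithin, mem_nhdsWithin_of_mem_nhds (hW.mem_nhds hyW)]
        with z hz hzW
      have h1 := hWS ⟨hzW, hz⟩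
      have h2 := hWS ⟨hyW, hyS⟩
      rw [h1.1, h2.1]
      exact hK.norm_sub_le h1.2 h2.2)
    rw [← norm_neg, hAv, norm_smul, Real.norm_eq_abs] at h
    exact le_of_mul_le_mul_right h (norm_pos_iff.2 hv0)

lemma maxCurvature_nonneg (S : Set E3) (n : E3 → S2) : 0 ≤ maxCurvature S n :=
  Real.sSup_nonneg (by rintro r ⟨x, hx, c, hc, rfl⟩; exact abs_nonneg c)

/-- The differential of the normal field along `S` is bounded by the greatest principal curvature,
because its restriction to the tangent plane is symmetric. -/
lemma norm_fderiv_normal_le (hS : IsCompact S) (hsm : IsSmoothSurface S)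
    (hn : IsUnitNormalField S n) (hx : x ∈ S) :
    ∃ A : E3 →L[ℝ] E3, HasFDerivWithinAt (fun y => (n y : E3)) A S x ∧
      ∀ v : E3, ⟪(n x : E3), v⟫ = 0 → ‖A v‖ ≤ maxCurvature S n * ‖v‖ := by
  obtain ⟨F, hF, hnF, hsymm⟩ := exists_smooth_extension_normal hsm hn hx
  have hA : HasFDerivWithinAt (fun y => (n y : E3)) (fderiv ℝ F x) S x :=
    (hF.differentiableAt one_ne_zero).hasFDerivAt.hasFDerivWithinAt.congr_of_eventuallyEq hnF
      (hnF.self_of_nhdsWithin hx)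
  refine ⟨fderiv ℝ F x, hA, ?_⟩
  set A := fderiv ℝ F x with hAdef
  let T : Submodule ℝ E3 := (ℝ ∙ (n x : E3))ᗮ
  have hT : ∀ v, v ∈ T ↔ ⟪(n x : E3), v⟫ = 0 := fun v => Submodule.mem_orthogonal_singleton_iff_inner_right
  -- Differentiating |n|² = 1 along a curve with velocity `v`.
  have hAT : ∀ v ∈ T, A v ∈ T := by
    intro v hv
    rw [hT] at hv ⊢
    obtain ⟨γ, h0, hγS, hγ⟩ := isTangentVector_of_inner_eq_zero hsm hn hx hv
    have h1 := hasDerivAt_normal_comp hA h0 hγS hγ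
    have h2 := h1.inner ℝ h1
    have h3 : HasDerivAt (fun t => ⟪(n (γ t) : E3), (n (γ t) : E3)⟫) 0 0 := by
      simp only [inner_self_S2]
      exact hasDerivAt_const _ _
    have h4 := h2.unique h3
    rw [h0, real_inner_comm (n x : E3)] at h4
    have h5 : ⟪(n x : E3), A v⟫ = 0 := by linarith
    exact h5
  let B : T →ₗ[ℝ] T := (A : E3 →ₗ[ℝ] E3).restrict hAT
  have hB : B.IsSymmetric := by
    intro v w
    change ⟪A v, (w : E3)⟫ = ⟪(v : E3), A w⟫
    rw [hsymm v w ((hT _).1 v.2) ((hT _).1 w.2), real_inner_comm]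
  have heig : ∀ i, |hB.eigenvalues rfl i| ≤ maxCurvature S n := by
    intro i
    let b := hB.eigenvectorBasis rfl i
    refine le_csSup (bddAbove_principalCurvatures hS hsm hn)
      ⟨x, hx, -hB.eigenvalues rfl i, ⟨A, hA, b, ?_, ?_, ?_⟩, (abs_neg _).symm⟩
    · exact isTangentVector_of_inner_eq_zero hsm hn hx ((hT _).1 b.2)
    · have : ‖b‖ = 1 := (hB.eigenvectorBasis rfl).orthonormal.1 i
      intro h
      rw [show b = 0 from Subtype.ext h] at this
      simp at this
    · have h := congrArg (Subtype.val) (hB.apply_eigenvectorBasis rfl i)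
      change A b = _ at h
      rw [h]
      simp [b]
  intro v hv
  let v' : T := ⟨v, (hT v).2 hv⟩
  have hnorm : ‖B v'‖ ≤ maxCurvature S n * ‖v'‖ := by
    refine le_of_sq_le_sq ?_ (mul_nonneg (maxCurvature_nonneg S n) (norm_nonneg _))
    rw [mul_pow, ← (hB.eigenvectorBasis rfl).repr.norm_map (B v'),
      ← (hB.eigenvectorBasis rfl).repr.norm_map v', EuclideanSpace.norm_sq_eq,
      EuclideanSpace.norm_sq_eq, Finset.mul_sum]
    refine Finset.sum_le_sum fun i _ => ?_
    rw [hB.eigenvectorBasis_apply_self_apply rfl, norm_mul, mul_pow]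
    gcongr
    exact heig i
  exact hnorm

/-- The differential is controlled only on the tangent plane. A secant has a normal component of
lower order, and the gap between κ and `L` absorbs it together with the differentiation error. -/
lemma eventually_norm_normal_sub_le (hS : IsCompact S) (hsm : IsSmoothSurface S)
    (hn : IsUnitNormalField S n) (hx : x ∈ S) {L : ℝ} (hL : maxCurvature S n < L) :
    ∀ᶠ y in 𝓝[S] x, ‖(n y : E3) - n x‖ ≤ L * ‖y - x‖ := by
  obtain ⟨A, hA, hAle⟩ := norm_fderiv_normal_le hS hsm hn hx
  set κ := maxCurvature S n
  have hκ : 0 ≤ κ := maxCurvature_nonneg S n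
  set δ := (L - κ) / 2 with hδ
  have hδ0 : 0 < δ := by rw [hδ]; linarith
  have hM : 0 < κ + ‖A‖ + 1 := by positivity
  have h1 := hA.isLittleO.def hδ0
  have h2 := (isLittleO_inner_normal hsm hn hx).def (div_pos hδ0 hM)
  filter_upwards [h1, h2] with y h1 h2
  set w := (y - x) - ⟪(n x : E3), y - x⟫ • (n x : E3) with hw
  have hwn : ⟪(n x : E3), w⟫ = 0 := by
    rw [hw, inner_sub_right, inner_smul_right, inner_self_S2]; ring
  have hyx : y - x = w + ⟪(n x : E3), y - x⟫ • (n x : E3) := by rw [hw]; abel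
  rw [Real.norm_eq_abs] at h2
  have hwle : ‖w‖ ≤ ‖y - x‖ := norm_sub_inner_smul_le (n x) (y - x)
  have h3 : ‖A (y - x)‖ ≤ κ * ‖y - x‖ + δ * ‖y - x‖ := by
    calc ‖A (y - x)‖ = ‖A w + ⟪(n x : E3), y - x⟫ • A (n x)‖ := by
          conv_lhs => rw [hyx, map_add, map_smul]
      _ ≤ ‖A w‖ + |⟪(n x : E3), y - x⟫| * ‖A (n x)‖ := by
          refine (norm_add_le _ _).trans ?_
          rw [norm_smul, Real.norm_eq_abs]
      _ ≤ κ * ‖y - x‖ + (δ / (κ + ‖A‖ + 1) * ‖y - x‖) * (κ + ‖A‖ + 1) := by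
          have hAn : ‖A (n x)‖ ≤ κ + ‖A‖ + 1 := by
            have := A.le_opNorm (n x)
            rw [norm_coe_S2] at this
            linarith
          gcongr
          exact (hAle w hwn).trans (by gcongr)
      _ = _ := by field_simp
  calc ‖(n y : E3) - n x‖ = ‖((n y : E3) - n x - A (y - x)) + A (y - x)‖ := by congr 1; abel
    _ ≤ _ := norm_add_le _ _
    _ ≤ δ * ‖y - x‖ + (κ * ‖y - x‖ + δ * ‖y - x‖) := add_le_add h1 h3
    _ = _ := by rw [hδ]; ring

/-- The squared distance to x, along a curve on S whose velocity is the tangential part of x - y, is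
minimal at y; so this part is orthogonal to x - y and vanishes. -/
lemma IsClosestPoint.sub_eq_smul_normal (hsm : IsSmoothSurface S) (hn : IsUnitNormalField S n)
    (h : IsClosestPoint S x y) : x - y = ⟪(n y : E3), x - y⟫ • (n y : E3) := by
  set v := (x - y) - ⟪(n y : E3), x - y⟫ • (n y : E3) with hv
  have hvn : ⟪(n y : E3), v⟫ = 0 := by
    rw [hv, inner_sub_right, inner_smul_right, inner_self_S2]; ring
  obtain ⟨γ, h0, hγS, hγ⟩ := isTangentVector_of_inner_eq_zero hsm hn h.1 hvn
  have hd := (hγ.const_sub x).norm_sq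
  have hmin : IsLocalMin (fun t => ‖x - γ t‖ ^ 2) 0 := by
    filter_upwards [hγS] with t ht
    have := h.2 _ ht
    rw [dist_eq_norm, dist_eq_norm] at this
    rw [h0]
    gcongr
  have h1 := hmin.hasDerivAt_eq_zero hd
  have h2 : ⟪x - y, v⟫ = 0 := by
    rw [h0, inner_neg_right] at h1
    linarith
  have h3 : ⟪v, v⟫ = 0 := by
    conv_lhs => arg 2; rw [hv]
    rw [inner_sub_left, inner_smul_left, hvn, h2]
    simp
  exact sub_eq_zero.1 (inner_self_eq_zero.1 h3)

end

/-- A mean value inequality without differentiability: pointwise Lipschitz bounds with every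
constant above `C` integrate along the segment to the constant `C` itself. -/
lemma norm_image_sub_le_of_eventually {E F : Type*} [NormedAddCommGroup E] [NormedSpace ℝ E]
    [NormedAddCommGroup F] [NormedSpace ℝ F] {K : Set E} (hK : Convex ℝ K) {φ : E → F} {C : ℝ}
    (h : ∀ C', C < C' → ∀ x ∈ K, ∀ᶠ y in 𝓝[K] x, ‖φ y - φ x‖ ≤ C' * ‖y - x‖) {a b : E}
    (ha : a ∈ K) (hb : b ∈ K) : ‖φ b - φ a‖ ≤ C * ‖b - a‖ := by
  rcases eq_or_ne a b with rfl | hab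
  · simp
  have hba : 0 < ‖b - a‖ := norm_pos_iff.2 (sub_ne_zero.2 hab.symm)
  set z : ℝ → E := fun s => a + s • (b - a) with hz
  have hzK : ∀ s ∈ Set.Icc (0 : ℝ) 1, z s ∈ K := fun s hs =>
    hK.add_smul_sub_mem ha hb hs
  have hzc : Continuous z := by fun_prop
  have hloc : ∀ C', C < C' → ∀ s ∈ Set.Icc (0 : ℝ) 1, ∀ᶠ t in 𝓝[Set.Icc 0 1] s,
      ‖φ (z t) - φ (z s)‖ ≤ C' * ‖b - a‖ * |t - s| := by
    intro C' hC' s hs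
    have ht : Tendsto z (𝓝[Set.Icc 0 1] s) (𝓝[K] (z s)) :=
      tendsto_nhdsWithin_iff.2 ⟨hzc.continuousWithinAt, by
        filter_upwards [self_mem_nhdsWithin] with t ht using hzK t ht⟩
    filter_upwards [ht.eventually (h C' hC' _ (hzK s hs))] with t ht
    have : z t - z s = (t - s) • (b - a) := by simp only [hz]; module
    rw [this, norm_smul, Real.norm_eq_abs] at ht
    linarith
  have hcont : ContinuousOn (fun s => φ (z s) - φ (z 0)) (Set.Icc 0 1) := by
    intro s hs
    refine ContinuousWithinAt.sub ?_ continuousWithinAt_const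
    rw [ContinuousWithinAt, tendsto_iff_norm_sub_tendsto_zero]
    refine squeeze_zero' (Eventually.of_forall fun _ => norm_nonneg _)
      (hloc (C + 1) (by linarith) s hs) ?_
    have : Continuous fun t : ℝ => (C + 1) * ‖b - a‖ * |t - s| := by fun_prop
    simpa using (this.continuousWithinAt (s := Set.Icc 0 1) (x := s)).tendsto
  refine le_of_forall_pos_le_add fun δ hδ => ?_
  have key := image_norm_le_of_liminf_right_slope_norm_lt_deriv_boundary
    (f' := fun _ => C * ‖b - a‖) (B := fun s => (C * ‖b - a‖ + δ) * s)
    (B' := fun _ => C * ‖b - a‖ + δ) hcont ?_ (by simp) (by fun_prop) ?_ ?_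
    (Set.right_mem_Icc.2 zero_le_one)
  · simpa [hz] using key
  · intro s hs r hr
    obtain ⟨C', hC', hr'⟩ : ∃ C', C < C' ∧ C' * ‖b - a‖ < r := by
      obtain ⟨C', h1, h2⟩ := exists_between ((lt_div_iff₀ hba).2 hr)
      exact ⟨C', h1, (lt_div_iff₀ hba).1 h2⟩
    have hle : 𝓝[>] s ≤ 𝓝[Set.Icc 0 1] s := by
      rw [← nhdsWithin_Ioc_eq_nhdsGT hs.2]
      exact nhdsWithin_mono _ fun t ht => ⟨hs.1.trans ht.1.le, ht.2⟩
    refine Eventually.frequently ?_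
    filter_upwards [hle (hloc C' hC' s ⟨hs.1, hs.2.le⟩), self_mem_nhdsWithin] with t ht hts
    have hts' : 0 < t - s := sub_pos.2 hts
    rw [slope_def_field, div_lt_iff₀ hts']
    rw [abs_of_pos hts'] at ht
    have h1 := norm_sub_norm_le (φ (z t) - φ (z 0)) (φ (z s) - φ (z 0))
    rw [sub_sub_sub_cancel_right] at h1
    simp only [Function.comp]
    nlinarith
  · intro s _
    simpa using ((hasDerivAt_id s).const_mul (C * ‖b - a‖ + δ)).hasDerivWithinAt
  · intro s _ _
    linarith

/-! ### The closest-point projection on a convex set near the surface -/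

section Projection

variable {S K : Set E3} {n : E3 → S2} {ξ : E3 → E3} {η : ℝ}

/-- `ξ` is a continuous choice of closest points of `S` to the points of `K`, which are at distance
at most `η` from `S`, and `η` is at most a quarter of the least curvature radius. -/
structure IsNearProjection (S : Set E3) (n : E3 → S2) (K : Set E3) (ξ : E3 → E3) (η : ℝ) :
    Prop where
  isCompact : IsCompact S
  isSmooth : IsSmoothSurface S
  isNormal : IsUnitNormalField S n
  convex : Convex ℝ K
  isClosest : ∀ x ∈ K, IsClosestPoint S x (ξ x)
  continuousOn : ContinuousOn ξ K
  dist_le : ∀ x ∈ K, ‖x - ξ x‖ ≤ η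
  nonneg : 0 ≤ η
  curvature_mul_le : maxCurvature S n * η ≤ 1 / 4

namespace IsNearProjection

variable {x y : E3}

lemma mem (h : IsNearProjection S n K ξ η) (hx : x ∈ K) : ξ x ∈ S := (h.isClosest x hx).1

lemma tendsto (h : IsNearProjection S n K ξ η) (hx : x ∈ K) :
    Tendsto ξ (𝓝[K] x) (𝓝[S] (ξ x)) :=
  tendsto_nhdsWithin_iff.2 ⟨h.continuousOn x hx, by
    filter_upwards [self_mem_nhdsWithin] with y hy using h.mem hy⟩

lemma eq_add_smul (h : IsNearProjection S n K ξ η) (hx : x ∈ K) :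
    x = ξ x + ⟪(n (ξ x) : E3), x - ξ x⟫ • (n (ξ x) : E3) := by
  rw [← (h.isClosest x hx).sub_eq_smul_normal h.isSmooth h.isNormal]; abel

lemma abs_height_le (h : IsNearProjection S n K ξ η) (hx : x ∈ K) :
    |⟪(n (ξ x) : E3), x - ξ x⟫| ≤ η := by
  refine (abs_real_inner_le_norm _ _).trans ?_
  rw [norm_coe_S2, one_mul]
  exact h.dist_le x hx

lemma eventually_norm_sub_le (h : IsNearProjection S n K ξ η) (hx : x ∈ K) :
    ∀ᶠ y in 𝓝[K] x, ‖ξ y - ξ x‖ ≤ 2 * ‖y - x‖ := by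
  have hη := h.nonneg
  -- Chosen so that η times this excess is at most 1/8; with κη ≤ 1/4, the variation of the normal
  -- contributes at most 3/8 of ‖d‖.
  have hδ : 0 < 1 / (8 * (η + 1)) := by positivity
  have h1 := (h.tendsto hx).eventually (eventually_norm_normal_sub_le h.isCompact h.isSmooth
    h.isNormal (h.mem hx) (lt_add_of_pos_right _ hδ))
  have h2 := (h.tendsto hx).eventually ((isLittleO_inner_normal h.isSmooth h.isNormal
    (h.mem hx)).def (show (0 : ℝ) < 1 / 8 by norm_num))
  filter_upwards [h1, h2, self_mem_nhdsWithin] with y h1 h2 hy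
  have hyE := h.eq_add_smul hy
  have hxE := h.eq_add_smul hx
  have hT := h.abs_height_le hy
  rw [Real.norm_eq_abs] at h2
  set t' := ⟪(n (ξ y) : E3), y - ξ y⟫
  set t := ⟪(n (ξ x) : E3), x - ξ x⟫
  set N := (n (ξ x) : E3) with hN
  set m := (n (ξ y) : E3) - N with hm
  set d := ξ y - ξ x with hd
  have hdiff : y - x = d + t' • m + (t' - t) • N := by
    rw [hd, hm]
    nth_rewrite 1 [hyE]
    nth_rewrite 1 [hxE]
    module
  have hNN : ⟪N, N⟫ = 1 := inner_self_S2 _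
  -- Projecting to the tangent plane at ξ x removes the unknown change of height. What remains is d
  -- up to errors of 3/8 and 1/8 of its norm, whence the Lipschitz constant 2.
  have hproj : (y - x) - ⟪N, y - x⟫ • N =
      d + t' • (m - ⟪N, m⟫ • N) - ⟪N, d⟫ • N := by
    rw [hdiff, inner_add_right, inner_add_right, inner_smul_right, inner_smul_right, hNN]
    module
  have hle := norm_sub_inner_smul_le (n (ξ x)) (y - x)
  rw [← hN, hproj] at hle
  have hmle : ‖t' • (m - ⟪N, m⟫ • N)‖ ≤ 3 / 8 * ‖d‖ := by
    rw [norm_smul, Real.norm_eq_abs]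
    calc |t'| * ‖m - ⟪N, m⟫ • N‖
        ≤ η * ((maxCurvature S n + 1 / (8 * (η + 1))) * ‖d‖) := by
          gcongr
          exact (norm_sub_inner_smul_le (n (ξ x)) m).trans h1
      _ = (maxCurvature S n * η + η / (η + 1) / 8) * ‖d‖ := by field_simp
      _ ≤ (1 / 4 + 1 / 8) * ‖d‖ := by
          gcongr
          · exact h.curvature_mul_le
          · exact (div_le_one (by positivity)).2 (by linarith)
      _ = _ := by ring
  have hNd : ‖⟪N, d⟫ • N‖ ≤ 1 / 8 * ‖d‖ := by
    rw [norm_smul, hN, norm_coe_S2, mul_one]; exact h2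
  have h3 : ‖d‖ ≤ ‖d + t' • (m - ⟪N, m⟫ • N) - ⟪N, d⟫ • N‖ + ‖t' • (m - ⟪N, m⟫ • N)‖
      + ‖⟪N, d⟫ • N‖ := by
    calc ‖d‖ = ‖(d + t' • (m - ⟪N, m⟫ • N) - ⟪N, d⟫ • N) - t' • (m - ⟪N, m⟫ • N)
        + ⟪N, d⟫ • N‖ := by congr 1; abel
      _ ≤ _ := (norm_add_le _ _).trans (by gcongr; exact norm_sub_le _ _)
  linarith

lemma norm_sub_le (h : IsNearProjection S n K ξ η) (hx : x ∈ K) (hy : y ∈ K) :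
    ‖ξ y - ξ x‖ ≤ 2 * ‖y - x‖ := by
  refine norm_image_sub_le_of_eventually h.convex (fun C' hC' z hz => ?_) hx hy
  filter_upwards [h.eventually_norm_sub_le hz] with w hw
  exact hw.trans (by gcongr)

lemma norm_normal_sub_le (h : IsNearProjection S n K ξ η) (hx : x ∈ K) (hy : y ∈ K) :
    ‖(n (ξ y) : E3) - n (ξ x)‖ ≤ 2 * maxCurvature S n * ‖y - x‖ := by
  have hκ := maxCurvature_nonneg S n
  refine norm_image_sub_le_of_eventually (φ := fun z => (n (ξ z) : E3)) h.convex
    (fun C' hC' z hz => ?_) hx hy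
  have h1 := (h.tendsto hz).eventually (eventually_norm_normal_sub_le h.isCompact h.isSmooth
    h.isNormal (h.mem hz) (show maxCurvature S n < C' / 2 by linarith))
  filter_upwards [h1, self_mem_nhdsWithin] with w hw hwK
  have := h.norm_sub_le hz hwK
  nlinarith

/-- Secants of the surface are almost orthogonal to the normal. -/
lemma abs_inner_normal_sub_le (h : IsNearProjection S n K ξ η) (hx : x ∈ K) (hy : y ∈ K) :
    |⟪(n (ξ x) : E3), ξ y - ξ x⟫| ≤ 4 * maxCurvature S n * ‖y - x‖ ^ 2 := by
  have hκ := maxCurvature_nonneg S n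
  have hsub : segment ℝ x y ⊆ K := h.convex.segment_subset hx hy
  -- Along the segment, the infinitesimal secant is orthogonal to the normal at its own base point.
  -- That normal differs from the one at ξ x by at most 2κ‖y - x‖, and ξ is 2-Lipschitz: hence the
  -- factor 4.
  have key := norm_image_sub_le_of_eventually (φ := fun z => ⟪(n (ξ x) : E3), ξ z⟫)
    (C := 4 * maxCurvature S n * ‖y - x‖) (convex_segment x y) ?_
    (left_mem_segment ℝ x y) (right_mem_segment ℝ x y)
  · rw [← inner_sub_right, Real.norm_eq_abs] at key
    exact key.trans (by rw [sq, mul_assoc])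
  intro C' hC' z hz
  have hδ : 0 < (C' - 4 * maxCurvature S n * ‖y - x‖) / 2 := by linarith
  have h1 := (h.tendsto (hsub hz)).eventually ((isLittleO_inner_normal h.isSmooth h.isNormal
    (h.mem (hsub hz))).def hδ)
  filter_upwards [nhdsWithin_mono _ hsub h1, self_mem_nhdsWithin] with w hw hwK
  rw [← inner_sub_right, Real.norm_eq_abs]
  rw [Real.norm_eq_abs] at hw
  have h2 := h.norm_sub_le (hsub hz) (hsub hwK)
  have h3 := h.norm_normal_sub_le hx (hsub hz)
  have h4 : ‖z - x‖ ≤ ‖y - x‖ := by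
    obtain ⟨s, hs, rfl⟩ := (segment_eq_image' ℝ x y).subset hz
    rw [add_sub_cancel_left, norm_smul, Real.norm_eq_abs, abs_of_nonneg hs.1]
    exact mul_le_of_le_one_left (norm_nonneg _) hs.2
  have h5 : ⟪(n (ξ x) : E3), ξ w - ξ z⟫ =
      ⟪(n (ξ z) : E3), ξ w - ξ z⟫ - ⟪(n (ξ z) : E3) - n (ξ x), ξ w - ξ z⟫ := by
    rw [inner_sub_left]; ring
  rw [h5]
  calc _ ≤ |⟪(n (ξ z) : E3), ξ w - ξ z⟫| + |⟪(n (ξ z) : E3) - n (ξ x), ξ w - ξ z⟫| := abs_sub _ _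
    _ ≤ (C' - 4 * maxCurvature S n * ‖y - x‖) / 2 * ‖ξ w - ξ z‖ +
        (2 * maxCurvature S n * ‖y - x‖) * ‖ξ w - ξ z‖ := by
        gcongr
        refine (abs_real_inner_le_norm _ _).trans ?_
        gcongr
        exact h3.trans (by gcongr)
    _ = C' / 2 * ‖ξ w - ξ z‖ := by ring
    _ ≤ C' / 2 * (2 * ‖w - z‖) := by
        have : 0 ≤ C' := le_trans (by positivity) hC'.le
        gcongr
    _ = _ := by ring

/-- The signed height over `S` varies slowly on a planar set almost parallel to `S`. -/
lemma abs_height_sub_le (h : IsNearProjection S n K ξ η) {ν : E3} {τ : ℝ}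
    (hν : ∀ z ∈ K, ∀ w ∈ K, ⟪ν, w - z⟫ = 0) (hnν : ∀ z ∈ K, ‖(n (ξ z) : E3) - ν‖ ≤ τ)
    (hx : x ∈ K) (hy : y ∈ K) :
    |⟪(n (ξ y) : E3), y - ξ y⟫ - ⟪(n (ξ x) : E3), x - ξ x⟫| ≤ τ * ‖y - x‖ := by
  have hκ := maxCurvature_nonneg S n
  have hη := h.nonneg
  refine norm_image_sub_le_of_eventually (φ := fun z => ⟪(n (ξ z) : E3), z - ξ z⟫) h.convex
    (fun C' hC' z hz => ?_) hx hy
  set κ := maxCurvature S n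
  -- Two thirds of the slack pay for the secant of S, as ξ is 2-Lipschitz; the last third pays for
  -- the quadratic term from turning the normal.
  have hδ : 0 < (C' - τ) / 3 := by linarith
  have h1 := (h.tendsto hz).eventually ((isLittleO_inner_normal h.isSmooth h.isNormal
    (h.mem hz)).def hδ)
  have h2 : ∀ᶠ w in 𝓝[K] z, 2 * η * κ ^ 2 * ‖w - z‖ < (C' - τ) / 3 := by
    have hc : Continuous fun w => 2 * η * κ ^ 2 * ‖w - z‖ := by fun_prop
    have := (hc.continuousWithinAt (s := K) (x := z)).tendsto
    rw [sub_self, norm_zero, mul_zero] at this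
    exact this.eventually (gt_mem_nhds hδ)
  filter_upwards [h1, h2, self_mem_nhdsWithin] with w h1 h2 hw
  have hwE := h.eq_add_smul hw
  have hzE := h.eq_add_smul hz
  have hT := h.abs_height_le hw
  have hm := h.norm_normal_sub_le hz hw
  have hd := h.norm_sub_le hz hw
  rw [Real.norm_eq_abs] at h1 ⊢
  have hNν : |⟪(n (ξ z) : E3), w - z⟫| ≤ τ * ‖w - z‖ := by
    have : ⟪(n (ξ z) : E3), w - z⟫ = ⟪(n (ξ z) : E3) - ν, w - z⟫ := by
      rw [inner_sub_left, hν z hz w hw, sub_zero]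
    rw [this]
    refine (abs_real_inner_le_norm _ _).trans ?_
    gcongr
    exact hnν z hz
  set t' := ⟪(n (ξ w) : E3), w - ξ w⟫
  set t := ⟪(n (ξ z) : E3), z - ξ z⟫
  have hnn : ⟪(n (ξ z) : E3), (n (ξ w) : E3)⟫ = 1 - ‖(n (ξ w) : E3) - n (ξ z)‖ ^ 2 / 2 := by
    rw [norm_sub_sq_real, norm_coe_S2, norm_coe_S2, real_inner_comm]; ring
  have heq : t' - t = ⟪(n (ξ z) : E3), w - z⟫ - ⟪(n (ξ z) : E3), ξ w - ξ z⟫ +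
      t' * (‖(n (ξ w) : E3) - n (ξ z)‖ ^ 2 / 2) := by
    have : w - z = (ξ w - ξ z) + t' • (n (ξ w) : E3) - t • (n (ξ z) : E3) := by
      nth_rewrite 1 [hwE]
      nth_rewrite 1 [hzE]
      abel
    rw [this, inner_sub_right, inner_add_right, inner_smul_right, inner_smul_right, hnn,
      inner_self_S2]
    ring
  have hq : |t' * (‖(n (ξ w) : E3) - n (ξ z)‖ ^ 2 / 2)| ≤ (C' - τ) / 3 * ‖w - z‖ := by
    rw [abs_mul, abs_of_nonneg (show 0 ≤ ‖(n (ξ w) : E3) - n (ξ z)‖ ^ 2 / 2 by positivity)]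
    calc _ ≤ η * ((2 * κ * ‖w - z‖) ^ 2 / 2) := by gcongr
      _ = (2 * η * κ ^ 2 * ‖w - z‖) * ‖w - z‖ := by ring
      _ ≤ _ := by gcongr
  have hd' : |⟪(n (ξ z) : E3), ξ w - ξ z⟫| ≤ (C' - τ) / 3 * (2 * ‖w - z‖) :=
    h1.trans (by gcongr)
  rw [heq]
  calc _ ≤ |⟪(n (ξ z) : E3), w - z⟫| + |⟪(n (ξ z) : E3), ξ w - ξ z⟫| +
        |t' * (‖(n (ξ w) : E3) - n (ξ z)‖ ^ 2 / 2)| :=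
        (abs_add_le _ _).trans (by gcongr; exact abs_sub _ _)
    _ ≤ τ * ‖w - z‖ + (C' - τ) / 3 * (2 * ‖w - z‖) + (C' - τ) / 3 * ‖w - z‖ := by gcongr
    _ = _ := by ring

/-- On a planar set almost parallel to `S`, the projection to `S` is almost an isometry. -/
lemma norm_sub_sub_sub_le (h : IsNearProjection S n K ξ η) {ν : E3} {τ : ℝ}
    (hτ : 2 * maxCurvature S n * η ≤ τ) (hν : ∀ z ∈ K, ∀ w ∈ K, ⟪ν, w - z⟫ = 0)
    (hnν : ∀ z ∈ K, ‖(n (ξ z) : E3) - ν‖ ≤ τ) (hx : x ∈ K) (hy : y ∈ K) :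
    ‖(ξ y - ξ x) - (y - x)‖ ≤ 2 * τ * ‖y - x‖ := by
  have hκ := maxCurvature_nonneg S n
  have hη := h.nonneg
  have hyE := h.eq_add_smul hy
  have hxE := h.eq_add_smul hx
  have hT := h.abs_height_le hx
  have hm := h.norm_normal_sub_le hx hy
  have ht := h.abs_height_sub_le hν hnν hx hy
  set t' := ⟪(n (ξ y) : E3), y - ξ y⟫
  set t := ⟪(n (ξ x) : E3), x - ξ x⟫
  have heq : (ξ y - ξ x) - (y - x) =
      -((t' - t) • (n (ξ y) : E3) + t • ((n (ξ y) : E3) - n (ξ x))) := by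
    nth_rewrite 2 [hyE]
    nth_rewrite 2 [hxE]
    module
  rw [heq, norm_neg]
  calc _ ≤ |t' - t| * 1 + |t| * ‖(n (ξ y) : E3) - n (ξ x)‖ := by
        refine (norm_add_le _ _).trans ?_
        rw [norm_smul, norm_smul, norm_coe_S2, Real.norm_eq_abs, Real.norm_eq_abs]
    _ ≤ τ * ‖y - x‖ * 1 + η * (2 * maxCurvature S n * ‖y - x‖) := by gcongr
    _ = (τ + 2 * maxCurvature S n * η) * ‖y - x‖ := by ring
    _ ≤ (τ + τ) * ‖y - x‖ := by gcongr
    _ = _ := by ring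

end IsNearProjection

end Projection

/-- A unit vector almost orthogonal to two directions is almost parallel to the common normal of
these directions. -/
lemma one_sub_inner_sq_le {N ν a b : E3} {δ s : ℝ} (hN : ‖N‖ = 1) (hν : ‖ν‖ = 1) (ha : a ≠ 0)
    (hb : b ≠ 0) (hνa : ⟪ν, a⟫ = 0) (hνb : ⟪ν, b⟫ = 0) (hNa : |⟪N, a⟫| ≤ δ * ‖a‖)
    (hNb : |⟪N, b⟫| ≤ δ * ‖b‖) (hs : 0 < s)
    (hsin : s ≤ Real.sin (InnerProductGeometry.angle a b)) :
    1 - ⟪N, ν⟫ ^ 2 ≤ 5 * (δ / s) ^ 2 := by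
  set c := Real.cos (InnerProductGeometry.angle a b) with hc
  set σ := Real.sin (InnerProductGeometry.angle a b) with hσ
  have hσ0 : 0 < σ := hs.trans_le hsin
  have hcs : σ ^ 2 + c ^ 2 = 1 := Real.sin_sq_add_cos_sq _
  have ha0 : 0 < ‖a‖ := norm_pos_iff.2 ha
  have hb0 : 0 < ‖b‖ := norm_pos_iff.2 hb
  set e₁ : E3 := ‖a‖⁻¹ • a with he₁
  set e₂ : E3 := ‖b‖⁻¹ • b with he₂
  have h11 : ⟪e₁, e₁⟫ = 1 := by
    rw [he₁, inner_smul_left, inner_smul_right, real_inner_self_eq_norm_sq]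
    simp; field_simp
  have h22 : ⟪e₂, e₂⟫ = 1 := by
    rw [he₂, inner_smul_left, inner_smul_right, real_inner_self_eq_norm_sq]
    simp; field_simp
  have h12 : ⟪e₁, e₂⟫ = c := by
    rw [he₁, he₂, hc, InnerProductGeometry.cos_angle, inner_smul_left, inner_smul_right]
    simp; field_simp
  have h21 : ⟪e₂, e₁⟫ = c := by rw [real_inner_comm, h12]
  have hν1 : ⟪ν, e₁⟫ = 0 := by rw [he₁, inner_smul_right, hνa, mul_zero]
  have hν2 : ⟪ν, e₂⟫ = 0 := by rw [he₂, inner_smul_right, hνb, mul_zero]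
  have hN1 : |⟪N, e₁⟫| ≤ δ := by
    rw [he₁, inner_smul_right, abs_mul, abs_inv, abs_norm, inv_mul_le_iff₀ ha0]; linarith
  have hN2 : |⟪N, e₂⟫| ≤ δ := by
    rw [he₂, inner_smul_right, abs_mul, abs_inv, abs_norm, inv_mul_le_iff₀ hb0]; linarith
  clear_value e₁ e₂
  have hc1 : |c| ≤ 1 := Real.abs_cos_le_one _
  -- Gram–Schmidt: e₁, e₃ and ν form an orthonormal basis. By Parseval, 1 - ⟪N, ν⟫² is the sum of
  -- the squares of two coordinates, at most δ/s and 2δ/s.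
  set e₃ : E3 := σ⁻¹ • (e₂ - c • e₁) with he₃
  have h13 : ⟪e₁, e₃⟫ = 0 := by
    rw [he₃, inner_smul_right, inner_sub_right, inner_smul_right, h12, h11]; ring
  have h33 : ⟪e₃, e₃⟫ = 1 := by
    rw [he₃, inner_smul_left, inner_smul_right, inner_sub_right, inner_sub_left, inner_sub_left,
      inner_smul_right, inner_smul_right, inner_smul_left, inner_smul_left, h11, h12, h21, h22]
    simp only [conj_trivial]
    field_simp
    linarith
  have hν3 : ⟪ν, e₃⟫ = 0 := by
    rw [he₃, inner_smul_right, inner_sub_right, inner_smul_right, hν1, hν2]; ring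
  have hνν : ⟪ν, ν⟫ = 1 := by rw [real_inner_self_eq_norm_sq, hν]; norm_num
  have hon : Orthonormal ℝ ![e₁, e₃, ν] := by
    have h31 : ⟪e₃, e₁⟫ = 0 := by rw [real_inner_comm, h13]
    have hν1' : ⟪e₁, ν⟫ = 0 := by rw [real_inner_comm, hν1]
    have hν3' : ⟪e₃, ν⟫ = 0 := by rw [real_inner_comm, hν3]
    rw [orthonormal_iff_ite]
    intro i j
    fin_cases i <;> fin_cases j <;> simp only [Fin.zero_eta, Fin.mk_one, Fin.reduceFinMk,
      Matrix.cons_val, h11, h13, h31, h33, hν1, hν1', hν3, hν3', hνν] <;> simp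
  let B : OrthonormalBasis (Fin 3) ℝ E3 :=
    (basisOfOrthonormalOfCardEqFinrank hon (by simp)).toOrthonormalBasis (by simpa using hon)
  have hB : ∀ i, B i = ![e₁, e₃, ν] i := fun i => by simp [B]
  have hsum := B.sum_sq_norm_inner_left N
  simp only [Fin.sum_univ_three, hB, Real.norm_eq_abs, sq_abs, hN] at hsum
  simp only [Matrix.cons_val] at hsum
  have hN3 : |⟪N, e₃⟫| ≤ 2 * δ / σ := by
    rw [he₃, inner_smul_right, abs_mul, abs_inv, abs_of_pos hσ0, inner_sub_right, inner_smul_right,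
      inv_mul_eq_div]
    gcongr
    refine (abs_sub _ _).trans ?_
    rw [abs_mul]
    nlinarith [abs_nonneg ⟪N, e₁⟫]
  have hδ : 0 ≤ δ := (abs_nonneg _).trans hN1
  have h1 : ⟪N, e₁⟫ ^ 2 ≤ (δ / s) ^ 2 := by
    rw [← sq_abs]
    gcongr
    refine hN1.trans (le_div_self hδ hs (hsin.trans (Real.sin_le_one _)))
  have h2 : ⟪N, e₃⟫ ^ 2 ≤ (2 * (δ / s)) ^ 2 := by
    rw [← sq_abs]
    gcongr
    refine hN3.trans ?_
    rw [mul_div_assoc]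
    gcongr
  nlinarith

/-! ### Edges, angles and normals of a mesh -/

namespace TriMesh

variable {X : TriMesh} {f : Finset E3} {p q r x y : E3}

lemma dist_le_maxEdge (hf : f ∈ X.faces) (hp : p ∈ f) (hq : q ∈ f) : dist p q ≤ X.maxEdge := by
  refine le_csSup (Set.Finite.bddAbove ?_) ⟨f, hf, p, hp, q, hq, rfl⟩
  refine ((X.faces.finite_toSet.biUnion fun f _ => f.finite_toSet.biUnion fun p _ =>
    f.finite_toSet.image fun q => dist p q)).subset ?_
  rintro r ⟨f, hf, p, hp, q, hq, rfl⟩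
  simp only [Set.mem_iUnion, Set.mem_image]
  exact ⟨f, hf, p, hp, q, hq, rfl⟩

lemma maxEdge_nonneg (X : TriMesh) : 0 ≤ X.maxEdge :=
  Real.sSup_nonneg (by rintro r ⟨f, hf, p, hp, q, hq, rfl⟩; exact dist_nonneg)

lemma dist_le_maxEdge_of_mem_convexHull (hf : f ∈ X.faces) (hx : x ∈ convexHull ℝ (f : Set E3))
    (hy : y ∈ convexHull ℝ (f : Set E3)) : dist x y ≤ X.maxEdge := by
  obtain ⟨p, hp, q, hq, hpq⟩ := convexHull_exists_dist_ge2 hx hy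
  exact hpq.trans (dist_le_maxEdge hf hp hq)

lemma center_mem (hf : f ∈ X.faces) : center f ∈ convexHull ℝ (f : Set E3) := by
  have h3 : ((f.card : ℕ) : ℝ) = 3 := by rw [X.card_eq f hf]; norm_num
  have hne : f.Nonempty := Finset.card_pos.1 (by rw [X.card_eq f hf]; norm_num)
  rw [center, Finset.smul_sum]
  refine (convex_convexHull ℝ (f : Set E3)).sum_mem (fun _ _ => by norm_num) ?_
    fun p hp => subset_convexHull ℝ _ hp
  rw [Finset.sum_const, nsmul_eq_mul, h3]; norm_num

lemma inner_normal_sub (hf : f ∈ X.faces) (hx : x ∈ convexHull ℝ (f : Set E3))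
    (hy : y ∈ convexHull ℝ (f : Set E3)) : ⟪(X.normal f : E3), y - x⟫ = 0 := by
  obtain ⟨p, hp⟩ : f.Nonempty := Finset.card_pos.1 (by rw [X.card_eq f hf]; norm_num)
  have key : ∀ z ∈ convexHull ℝ (f : Set E3), ⟪(X.normal f : E3), z⟫ = ⟪(X.normal f : E3), p⟫ := by
    intro z hz
    have hconv : Convex ℝ {z : E3 | ⟪(X.normal f : E3), z⟫ = ⟪(X.normal f : E3), p⟫} :=
      convex_hyperplane (innerₛₗ ℝ (X.normal f : E3)).isLinear _
    refine convexHull_min (fun q hq => ?_) hconv hz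
    have := X.normal_orthogonal f hf p hp q hq
    rw [inner_sub_right] at this
    exact sub_eq_zero.1 this
  rw [inner_sub_right, key x hx, key y hy, sub_self]

lemma bddBelow_angles (X : TriMesh) :
    BddBelow {r : ℝ | ∃ f ∈ X.faces, ∃ p ∈ f, ∃ q ∈ f, ∃ s ∈ f, p ≠ q ∧ q ≠ s ∧ p ≠ s ∧
      r = EuclideanGeometry.angle p q s} :=
  ⟨0, by rintro r ⟨f, -, p, -, q, -, s, -, -, -, -, rfl⟩; exact EuclideanGeometry.angle_nonneg _ _ _⟩

lemma minAngle_le (hf : f ∈ X.faces) (hp : p ∈ f) (hq : q ∈ f) (hr : r ∈ f) (hpq : p ≠ q)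
    (hqr : q ≠ r) (hpr : p ≠ r) : X.minAngle ≤ EuclideanGeometry.angle p q r :=
  csInf_le X.bddBelow_angles ⟨f, hf, p, hp, q, hq, r, hr, hpq, hqr, hpr, rfl⟩

lemma exists_eq_insert (hf : f ∈ X.faces) : ∃ p q r : E3, p ≠ q ∧ p ≠ r ∧ q ≠ r ∧ f = {p, q, r} :=
  Finset.card_eq_three.1 (X.card_eq f hf)

lemma not_collinear (hf : f ∈ X.faces) (hp : p ∈ f) (hq : q ∈ f) (hr : r ∈ f) (hpq : p ≠ q)
    (hqr : q ≠ r) (hpr : p ≠ r) : ¬ Collinear ℝ {p, q, r} := by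
  rw [← affineIndependent_iff_not_collinear_set]
  let φ : Fin 3 ↪ f := ⟨![⟨p, hp⟩, ⟨q, hq⟩, ⟨r, hr⟩], by
      intro i j
      fin_cases i <;> fin_cases j <;> simp [hpq, hqr, hpr, hpq.symm, hqr.symm, hpr.symm]⟩
  have h : ![p, q, r] = (Subtype.val : f → E3) ∘ φ := by
    funext i
    fin_cases i <;> rfl
  rw [h]
  exact (X.indep f hf).comp_embedding φ

lemma minAngle_pos (hf : f ∈ X.faces) : 0 < X.minAngle := by
  set A := {r : ℝ | ∃ f ∈ X.faces, ∃ p ∈ f, ∃ q ∈ f, ∃ s ∈ f, p ≠ q ∧ q ≠ s ∧ p ≠ s ∧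
    r = EuclideanGeometry.angle p q s} with hA
  have hfin : A.Finite := by
    refine ((X.faces.finite_toSet.biUnion fun f _ => f.finite_toSet.biUnion fun p _ =>
      f.finite_toSet.biUnion fun q _ => f.finite_toSet.image fun s =>
        EuclideanGeometry.angle p q s)).subset ?_
    rintro r ⟨f, hf, p, hp, q, hq, s, hs, -, -, -, rfl⟩
    simp only [Set.mem_iUnion, Set.mem_image]
    exact ⟨f, hf, p, hp, q, hq, s, hs, rfl⟩
  have hne : A.Nonempty := by
    obtain ⟨p, q, r, hpq, hpr, hqr, rfl⟩ := exists_eq_insert hf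
    exact ⟨_, _, hf, p, by simp, q, by simp, r, by simp, hpq, hqr, hpr, rfl⟩
  obtain ⟨g, hg, p, hp, q, hq, s, hs, hpq, hqs, hps, hr⟩ := hne.csInf_mem hfin
  change 0 < sInf A
  rw [hr]
  refine lt_of_le_of_ne (EuclideanGeometry.angle_nonneg _ _ _) fun h0 => ?_
  exact not_collinear hg hp hq hs hpq hqs hps
    (EuclideanGeometry.collinear_of_angle_eq_zero h0.symm)

lemma sin_minAngle_le (hf : f ∈ X.faces) (hp : p ∈ f) (hq : q ∈ f) (hr : r ∈ f) (hpq : p ≠ q)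
    (hqr : q ≠ r) (hpr : p ≠ r) :
    Real.sin X.minAngle ≤ Real.sin (EuclideanGeometry.angle p q r) := by
  have h1 := minAngle_le hf hp hq hr hpq hqr hpr
  have h2 := minAngle_le hf hq hr hp hqr hpr.symm hpq.symm
  have h3 := EuclideanGeometry.angle_add_angle_add_angle_eq_pi r hpq.symm
  have h4 := EuclideanGeometry.angle_nonneg r p q
  have h0 := minAngle_pos hf
  rcases le_total (EuclideanGeometry.angle p q r) (Real.pi / 2) with h | h
  · exact Real.sin_le_sin_of_le_of_le_pi_div_two (by linarith [Real.pi_pos]) h h1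
  -- For an obtuse angle, the supplement is the sum of the two other angles, hence at least the
  -- smallest one.
  · rw [← Real.sin_pi_sub (EuclideanGeometry.angle p q r)]
    exact Real.sin_le_sin_of_le_of_le_pi_div_two (by linarith [Real.pi_pos]) (by linarith)
      (by linarith)

lemma sin_minAngle_pos (hf : f ∈ X.faces) : 0 < Real.sin X.minAngle := by
  obtain ⟨p, q, r, hpq, hpr, hqr, rfl⟩ := exists_eq_insert hf
  refine Real.sin_pos_of_pos_of_lt_pi (minAngle_pos hf) ?_
  refine lt_of_le_of_ne ((minAngle_le hf (p := p) (q := q) (r := r) (by simp) (by simp) (by simp)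
    hpq hqr hpr).trans (EuclideanGeometry.angle_le_pi _ _ _)) fun h => ?_
  have h1 := minAngle_le hf (p := p) (q := q) (r := r) (by simp) (by simp) (by simp)
    hpq hqr hpr
  have h2 : EuclideanGeometry.angle p q r = Real.pi :=
    le_antisymm (EuclideanGeometry.angle_le_pi _ _ _) (h ▸ h1)
  exact not_collinear hf (p := p) (q := q) (r := r) (by simp) (by simp) (by simp)
    hpq hqr hpr (EuclideanGeometry.collinear_of_angle_eq_pi h2)

end TriMesh

/-- By compactness it suffices that every cluster point of ξ z, as z tends to x, is a closest point
to x; uniqueness then identifies it with ξ x. -/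
lemma continuousOn_of_isClosestPoint_iff {S K : Set E3} {ξ : E3 → E3} (hS : IsCompact S)
    (h : ∀ x ∈ K, ∀ y, IsClosestPoint S x y ↔ y = ξ x) : ContinuousOn ξ K := by
  intro x hx
  have hmem : ∀ᶠ z in 𝓝[K] x, ξ z ∈ S := by
    filter_upwards [self_mem_nhdsWithin] with z hz using ((h z hz _).2 rfl).1
  refine hS.tendsto_nhds_of_unique_mapClusterPt hmem fun y hy hcl => ?_
  refine (h x hx y).1 ⟨hy, fun w hw => ?_⟩
  refine le_of_forall_pos_le_add fun ε hε => ?_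
  have h1 := (mapClusterPt_iff_frequently.1 hcl) _ (Metric.ball_mem_nhds y (show 0 < ε / 3 by positivity))
  have h2 : ∀ᶠ z in 𝓝[K] x, z ∈ Metric.ball x (ε / 3) :=
    mem_nhdsWithin_of_mem_nhds (Metric.ball_mem_nhds x (by positivity))
  obtain ⟨z, ⟨hz1, hz2⟩, hzK⟩ := ((h1.and_eventually h2).and_eventually self_mem_nhdsWithin).exists
  have h3 := ((h z hzK _).2 rfl).2 w hw
  have h4 := dist_triangle4 x z (ξ z) y
  have h5 := dist_triangle z x w
  rw [Metric.mem_ball] at hz1 hz2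
  rw [dist_comm x z] at h4
  linarith

/-! ### Area of Lipschitz images and of triangles -/

lemma euclideanHausdorffMeasure_image_le {E F : Type*} [MetricSpace E] [MeasurableSpace E]
    [BorelSpace E] [MetricSpace F] [MeasurableSpace F] [BorelSpace F] {K : NNReal} {φ : E → F}
    {s : Set E} (h : LipschitzOnWith K φ s) : μHE[2] (φ '' s) ≤ (K : ENNReal) ^ 2 * μHE[2] s := by
  have h2 := h.hausdorffMeasure_image_le (d := 2) zero_le_two
  simp only [Measure.euclideanHausdorffMeasure_def, Measure.smul_apply, ENNReal.smul_def,
    smul_eq_mul, Nat.cast_ofNat]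
  rw [mul_left_comm]
  gcongr
  simpa using h2

lemma euclideanHausdorffMeasure_segment (p q : E3) : μHE[2] (segment ℝ p q) = 0 := by
  have h : μH[2] (segment ℝ p q) = 0 :=
    (Measure.hausdorffMeasure_zero_or_top (show (1 : ℝ) < 2 by norm_num) (segment ℝ p q)).resolve_right
      (by rw [hausdorffMeasure_segment]; exact edist_ne_top p q)
  simp [Measure.euclideanHausdorffMeasure_def, h]

lemma euclideanHausdorffMeasure_convexHull_eq_zero {t : Finset E3} (ht : t.card ≤ 2) :
    μHE[2] (convexHull ℝ (t : Set E3)) = 0 := by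
  obtain ⟨p, q, hpq⟩ : ∃ p q : E3, t ⊆ {p, q} := by
    interval_cases h : t.card
    · exact ⟨0, 0, by simp [Finset.card_eq_zero.1 h]⟩
    · obtain ⟨p, rfl⟩ := Finset.card_eq_one.1 h
      exact ⟨p, p, by simp⟩
    · obtain ⟨p, q, -, rfl⟩ := Finset.card_eq_two.1 h
      exact ⟨p, q, subset_rfl⟩
  refine measure_mono_null (t := segment ℝ p q) ?_ (euclideanHausdorffMeasure_segment p q)
  rw [← convexHull_pair]
  exact convexHull_mono (by simpa using Finset.coe_subset.2 hpq)

/-- The triangle lies in an affine, hence Lipschitz, image of the unit disk of the plane. -/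
lemma euclideanHausdorffMeasure_triangle_lt_top (p q r : E3) :
    μHE[2] (convexHull ℝ ({p, q, r} : Set E3)) < ⊤ := by
  let L : EuclideanSpace ℝ (Fin 2) →L[ℝ] E3 :=
    (EuclideanSpace.proj (𝕜 := ℝ) (0 : Fin 2)).smulRight (q - p) +
      (EuclideanSpace.proj (𝕜 := ℝ) (1 : Fin 2)).smulRight (r - p)
  have hL : ∀ z, L z = z 0 • (q - p) + z 1 • (r - p) := fun z => by simp [L]
  let B : Set (EuclideanSpace ℝ (Fin 2)) := Metric.closedBall 0 1
  have hlip : LipschitzOnWith ‖L‖₊ (fun z => p + L z) B := by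
    refine LipschitzOnWith.of_dist_le_mul fun z _ w _ => ?_
    rw [dist_add_left]
    exact L.lipschitz.dist_le_mul z w
  have hB : μHE[2] B < ⊤ := by
    rw [EuclideanSpace.euclideanHausdorffMeasure_eq_volume]
    exact (isCompact_closedBall _ _).measure_lt_top
  have hconv : Convex ℝ ((fun z => p + L z) '' B) := by
    have := ((convex_closedBall (0 : EuclideanSpace ℝ (Fin 2)) 1).linear_image L.toLinearMap).translate p
    rwa [Set.image_image] at this
  have hsub : convexHull ℝ ({p, q, r} : Set E3) ⊆ (fun z => p + L z) '' B := by
    refine convexHull_min ?_ hconv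
    rintro x (rfl | rfl | rfl)
    · exact ⟨0, by simp [B], by simp⟩
    · exact ⟨EuclideanSpace.single 0 1, by simp [B], by simp [hL]⟩
    · exact ⟨EuclideanSpace.single 1 1, by simp [B], by simp [hL]⟩
  refine (measure_mono hsub).trans_lt ((euclideanHausdorffMeasure_image_le hlip).trans_lt ?_)
  exact ENNReal.mul_lt_top (by simp) hB

namespace TriMesh

variable {X : TriMesh} {f g : Finset E3}

lemma measure_face_lt_top (hf : f ∈ X.faces) : μHE[2] (convexHull ℝ (f : Set E3)) < ⊤ := by
  obtain ⟨p, q, r, -, -, -, rfl⟩ := exists_eq_insert hf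
  simpa using euclideanHausdorffMeasure_triangle_lt_top p q r

lemma measure_inter_eq_zero (hf : f ∈ X.faces) (hg : g ∈ X.faces) (hfg : f ≠ g) :
    μHE[2] (convexHull ℝ ((f : Set E3) ∩ (g : Set E3))) = 0 := by
  classical
  rw [← Finset.coe_inter]
  refine euclideanHausdorffMeasure_convexHull_eq_zero ?_
  have h3 := X.card_eq f hf
  have h3' := X.card_eq g hg
  by_contra! hlt
  have h1 : f ∩ g = f := Finset.eq_of_subset_of_card_le Finset.inter_subset_left (by omega)
  have h2 : f ∩ g = g := Finset.eq_of_subset_of_card_le Finset.inter_subset_right (by omega)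
  exact hfg (h1.symm.trans h2)

end TriMesh

/-! ### Area distortion of almost isometric maps -/

section Bilipschitz

variable {K : Set E3} {ξ : E3 → E3} {δ : ℝ}

/-- The map and its inverse are Lipschitz with constants 1 + δ and 1/(1 - δ). The error is relative
to the image because the areas of the images add up to that of S. -/
lemma abs_measure_image_sub_le (hδ0 : 0 ≤ δ) (hδ : δ ≤ 3 / 10) (hK : μHE[2] K < ⊤)
    (h : ∀ x ∈ K, ∀ y ∈ K, ‖(ξ y - ξ x) - (y - x)‖ ≤ δ * ‖y - x‖) :
    μHE[2] (ξ '' K) < ⊤ ∧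
      |(μHE[2] (ξ '' K)).toReal - (μHE[2] K).toReal| ≤ 5 * δ * (μHE[2] (ξ '' K)).toReal := by
  have hup : LipschitzOnWith (1 + δ).toNNReal ξ K := by
    refine LipschitzOnWith.of_dist_le_mul fun y hy x hx => ?_
    rw [Real.coe_toNNReal _ (by linarith), dist_eq_norm, dist_eq_norm]
    have h1 := h x hx y hy
    have h2 := norm_sub_norm_le (ξ y - ξ x) (y - x)
    linarith
  have hlow : ∀ x ∈ K, ∀ y ∈ K, (1 - δ) * ‖y - x‖ ≤ ‖ξ y - ξ x‖ := by
    intro x hx y hy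
    have h1 := h x hx y hy
    have h2 := norm_sub_norm_le (y - x) (ξ y - ξ x)
    rw [norm_sub_rev (y - x) (ξ y - ξ x)] at h2
    linarith
  have hinj : Set.InjOn ξ K := by
    intro x hx y hy hxy
    have h1 := hlow x hx y hy
    rw [hxy, sub_self, norm_zero] at h1
    have h2 : ‖y - x‖ = 0 := by nlinarith [norm_nonneg (y - x)]
    exact (sub_eq_zero.1 (norm_eq_zero.1 h2)).symm
  have hinv : Set.LeftInvOn (Function.invFunOn ξ K) ξ K := hinj.leftInvOn_invFunOn
  have hdown : LipschitzOnWith (1 - δ)⁻¹.toNNReal (Function.invFunOn ξ K) (ξ '' K) := by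
    refine LipschitzOnWith.of_dist_le_mul ?_
    rintro _ ⟨y, hy, rfl⟩ _ ⟨x, hx, rfl⟩
    rw [hinv hy, hinv hx, Real.coe_toNNReal _ (inv_nonneg.2 (by linarith)), dist_eq_norm,
      dist_eq_norm, inv_mul_eq_div, le_div_iff₀ (by linarith), mul_comm]
    exact hlow x hx y hy
  have m1 := euclideanHausdorffMeasure_image_le hup
  have m2 := euclideanHausdorffMeasure_image_le hdown
  rw [hinv.image_image] at m2
  have hfin : μHE[2] (ξ '' K) < ⊤ := m1.trans_lt (ENNReal.mul_lt_top (by simp) hK)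
  refine ⟨hfin, ?_⟩
  have r1 := ENNReal.toReal_mono (ENNReal.mul_lt_top (by simp) hK).ne m1
  have r2 := ENNReal.toReal_mono (ENNReal.mul_lt_top (by simp) hfin).ne m2
  rw [ENNReal.toReal_mul, ENNReal.toReal_pow, ENNReal.coe_toReal,
    Real.coe_toNNReal _ (by linarith)] at r1
  rw [ENNReal.toReal_mul, ENNReal.toReal_pow, ENNReal.coe_toReal,
    Real.coe_toNNReal _ (inv_nonneg.2 (by linarith)), inv_pow, inv_mul_eq_div,
    le_div_iff₀ (by nlinarith)] at r2
  set a := (μHE[2] K).toReal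
  set b := (μHE[2] (ξ '' K)).toReal
  have ha : 0 ≤ a := ENNReal.toReal_nonneg
  have hb : 0 ≤ b := ENNReal.toReal_nonneg
  -- This is where the bound 3/10 serves; it equals 30ρ at the extreme value ρ = 1/100.
  have hc : 1 ≤ (1 + 5 * δ) * (1 - δ) ^ 2 := by
    nlinarith [mul_nonneg hδ0 (show 0 ≤ 3 - 9 * δ + 5 * δ ^ 2 by nlinarith)]
  have hc' : (1 - 5 * δ) * (1 + δ) ^ 2 ≤ 1 := by nlinarith
  rw [abs_le]
  constructor
  · have h1 : a * (1 - δ) ^ 2 ≤ (1 + 5 * δ) * b * (1 - δ) ^ 2 := by nlinarith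
    have := le_of_mul_le_mul_right h1 (by nlinarith)
    linarith
  · rcases le_total (1 - 5 * δ) 0 with h0 | h0
    · nlinarith
    · nlinarith [mul_le_mul_of_nonneg_left r1 h0]

end Bilipschitz

/-! ### Comparison of the two varifolds -/

section

variable {S : Set E3} {n : E3 → S2} {X : TriMesh} {ξ : E3 → E3} {f : Finset E3}

lemma TriMesh.convexHull_subset_space (hf : f ∈ X.faces) :
    convexHull ℝ (f : Set E3) ⊆ X.space :=
  Set.subset_biUnion_of_mem (u := fun f : Finset E3 => convexHull ℝ (f : Set E3)) hf

lemma TriMesh.isNearProjection (hS : IsCompact S) (hsm : IsSmoothSurface S)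
    (hn : IsUnitNormalField S n) (hXS : ∀ f ∈ X.faces, ∀ p ∈ f, p ∈ S)
    (hξ : ∀ x ∈ X.space, ∀ y, IsClosestPoint S x y ↔ y = ξ x)
    (hsmall : maxCurvature S n * X.maxEdge ≤ 1 / 100 * Real.sin X.minAngle) (hf : f ∈ X.faces) :
    IsNearProjection S n (convexHull ℝ (f : Set E3)) ξ X.maxEdge where
  isCompact := hS
  isSmooth := hsm
  isNormal := hn
  convex := convex_convexHull ℝ _
  isClosest x hx := (hξ x (convexHull_subset_space hf hx) _).2 rfl
  continuousOn := (continuousOn_of_isClosestPoint_iff hS hξ).mono (convexHull_subset_space hf)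
  dist_le x hx := by
    obtain ⟨p, hp⟩ : f.Nonempty := Finset.card_pos.1 (by rw [X.card_eq f hf]; norm_num)
    rw [← dist_eq_norm]
    exact (((hξ x (convexHull_subset_space hf hx) _).2 rfl).2 p (hXS f hf p hp)).trans
      (dist_le_maxEdge_of_mem_convexHull hf hx (subset_convexHull ℝ _ hp))
  nonneg := X.maxEdge_nonneg
  curvature_mul_le := by linarith [Real.sin_le_one X.minAngle]

/-- The normal of a face is close to the normals of the part of `S` over the face. -/
lemma TriMesh.norm_normal_sub_le (hS : IsCompact S) (hsm : IsSmoothSurface S)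
    (hn : IsUnitNormalField S n) (hXS : ∀ f ∈ X.faces, ∀ p ∈ f, p ∈ S)
    (hξ : ∀ x ∈ X.space, ∀ y, IsClosestPoint S x y ↔ y = ξ x)
    (hor : ∀ f ∈ X.faces, 0 < ⟪(X.normal f : E3), (n (ξ (center f)) : E3)⟫)
    (hsmall : maxCurvature S n * X.maxEdge ≤ 1 / 100 * Real.sin X.minAngle) (hf : f ∈ X.faces)
    {x : E3} (hx : x ∈ convexHull ℝ (f : Set E3)) :
    ‖(n (ξ x) : E3) - X.normal f‖ ≤
      15 * (maxCurvature S n * X.maxEdge / Real.sin X.minAngle) := by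
  have hP := isNearProjection hS hsm hn hXS hξ hsmall hf
  have hs0 := sin_minAngle_pos hf
  have hs1 := Real.sin_le_one X.minAngle
  have hκ := maxCurvature_nonneg S n
  have hη := X.maxEdge_nonneg
  obtain ⟨p, q, r, hpq, hpr, hqr, hfe⟩ := exists_eq_insert hf
  have hpf : p ∈ f := by simp [hfe]
  have hqf : q ∈ f := by simp [hfe]
  have hrf : r ∈ f := by simp [hfe]
  have hsub : ∀ v ∈ f, v ∈ convexHull ℝ (f : Set E3) := fun v hv => subset_convexHull ℝ _ hv
  -- Vertices lie on S, so the secant estimate applies to the edges themselves.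
  have hfix : ∀ v ∈ f, ξ v = v := fun v hv =>
    ((hξ v (convexHull_subset_space hf (hsub v hv)) v).1
      ⟨hXS f hf v hv, fun z _ => by rw [dist_self]; exact dist_nonneg⟩).symm
  have hedge : ∀ v ∈ f, |⟪(n p : E3), v - p⟫| ≤
      4 * (maxCurvature S n * X.maxEdge) * ‖v - p‖ := by
    intro v hv
    have h1 := hP.abs_inner_normal_sub_le (hsub p hpf) (hsub v hv)
    rw [hfix p hpf, hfix v hv] at h1
    have h2 := dist_le_maxEdge hf hv hpf
    rw [dist_eq_norm] at h2
    calc _ ≤ _ := h1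
      _ = 4 * (maxCurvature S n * ‖v - p‖) * ‖v - p‖ := by ring
      _ ≤ _ := by gcongr
  set s := Real.sin X.minAngle
  set ρ := maxCurvature S n * X.maxEdge / s with hρ
  have hρ0 : 0 ≤ ρ := by positivity
  have hρ1 : ρ ≤ 1 / 100 := by rw [hρ, div_le_iff₀ hs0]; exact hsmall
  have hκη : maxCurvature S n * X.maxEdge ≤ ρ := by
    rw [hρ]; exact le_div_self (by positivity) hs0 hs1
  have hvar : ∀ y ∈ convexHull ℝ (f : Set E3), ‖(n (ξ y) : E3) - n p‖ ≤ 2 * ρ := by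
    intro y hy
    have h1 := hP.norm_normal_sub_le (hsub p hpf) hy
    have h2 := dist_le_maxEdge_of_mem_convexHull hf hy (hsub p hpf)
    rw [dist_eq_norm] at h2
    rw [hfix p hpf] at h1
    calc _ ≤ _ := h1
      _ ≤ 2 * maxCurvature S n * X.maxEdge := by gcongr
      _ ≤ _ := by linarith
  have hpar := one_sub_inner_sq_le (norm_coe_S2 (n p)) (norm_coe_S2 (X.normal f))
    (sub_ne_zero.2 hpq.symm) (sub_ne_zero.2 hpr.symm)
    (X.normal_orthogonal f hf p hpf q hqf) (X.normal_orthogonal f hf p hpf r hrf)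
    (hedge q hqf) (hedge r hrf) hs0 (sin_minAngle_le hf hqf hpf hrf hpq.symm hpr hqr)
  rw [mul_div_assoc, ← hρ] at hpar
  set c := ⟪(n p : E3), (X.normal f : E3)⟫ with hc
  have hc1 : c ≤ 1 := by
    have := real_inner_le_norm (n p : E3) (X.normal f : E3)
    rwa [norm_coe_S2, norm_coe_S2, one_mul] at this
  have hclow : -(1 / 50) ≤ c := by
    have h1 := hvar _ (center_mem hf)
    have h2 := hor f hf
    have h3 : |⟪(n (ξ (center f)) : E3) - n p, (X.normal f : E3)⟫| ≤ 2 * ρ := by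
      refine (abs_real_inner_le_norm _ _).trans ?_
      rwa [norm_coe_S2, mul_one]
    rw [inner_sub_left, real_inner_comm, ← hc] at h3
    linarith [(abs_le.1 h3).2]
  -- A negative c would be at least -1/50, whereas c² ≥ 1 - 80ρ² is close to 1.
  have hc0 : 0 ≤ c := by
    by_contra! hneg
    nlinarith
  -- Since c ≥ 0, 2 - 2c ≤ 2(1 - c²) ≤ 160ρ², which is below (13ρ)².
  have hNν : ‖(n p : E3) - X.normal f‖ ≤ 13 * ρ := by
    refine le_of_sq_le_sq ?_ (by positivity)
    rw [norm_sub_sq_real, norm_coe_S2, norm_coe_S2, ← hc]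
    nlinarith
  calc _ ≤ ‖(n (ξ x) : E3) - n p‖ + ‖(n p : E3) - X.normal f‖ := norm_sub_le_norm_sub_add_norm_sub _ _ _
    _ ≤ 2 * ρ + 13 * ρ := add_le_add (hvar x hx) hNν
    _ = _ := by ring

lemma abs_setIntegral_sub_le {μ : Measure E3} {T : Set E3} (hfin : μ T < ⊤)
    {v : E3 → ℝ} (hv : IntegrableOn v T μ) {c a b M B : ℝ} (hB : ∀ y ∈ T, |v y - c| ≤ B)
    (hc : |c| ≤ M) (hb : 0 ≤ b) (ha : |(μ T).toReal - a| ≤ b * (μ T).toReal) :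
    |(∫ y in T, v y ∂μ) - a * c| ≤ (μ T).toReal * (B + b * M) := by
  have h1 : |∫ y in T, (v y - c) ∂μ| ≤ B * (μ T).toReal :=
    norm_setIntegral_le_of_norm_le_const (f := fun y => v y - c) (C := B) hfin hB
  have h2 : ∫ y in T, (v y - c) ∂μ = (∫ y in T, v y ∂μ) - (μ T).toReal * c := by
    rw [integral_sub hv (integrableOn_const hfin.ne), setIntegral_const, smul_eq_mul]
    rfl
  have h3 : |((μ T).toReal - a) * c| ≤ b * (μ T).toReal * M := by
    rw [abs_mul]; gcongr
  calc _ = |(∫ y in T, (v y - c) ∂μ) + ((μ T).toReal - a) * c| := by rw [h2]; congr 1; ring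
    _ ≤ B * (μ T).toReal + b * (μ T).toReal * M := (abs_add_le _ _).trans (add_le_add h1 h3)
    _ = _ := by ring

lemma IsLip.nonneg {u : E3 × S2 → ℝ} {k : ℝ} (hu : IsLip u k) (m : S2) :
    0 ≤ k := by
  have h := hu (0 : E3) (EuclideanSpace.single 0 1) m m
  have h1 : dist (0 : E3) (EuclideanSpace.single 0 1) = 1 := by simp
  rw [h1, dist_self] at h
  linarith [abs_nonneg (u (0, m) - u (EuclideanSpace.single 0 1, m))]

lemma IsLip.continuous {u : E3 × S2 → ℝ} {k : ℝ} (hu : IsLip u k) (hk : 0 ≤ k) :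
    Continuous u := by
  refine (LipschitzWith.of_dist_le_mul (K := (2 * k).toNNReal) fun z w => ?_).continuous
  rw [Real.coe_toNNReal _ (by positivity), Real.dist_eq]
  refine (hu z.1 w.1 z.2 w.2).trans ?_
  have h1 : dist z.1 w.1 ≤ dist z w := le_max_left _ _
  have h2 : dist z.2 w.2 ≤ dist z w := le_max_right _ _
  nlinarith

lemma abs_le_supNorm {u : E3 × S2 → ℝ} (hb : BddAbove (Set.range fun z => |u z|)) (z : E3 × S2) :
    |u z| ≤ supNorm u := le_ciSup hb z

lemma TriMesh.integral_varifold {u : E3 × S2 → ℝ} (hu : Continuous u) (X : TriMesh) :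
    ∫ z, u z ∂X.varifold = ∑ f ∈ X.faces,
      (μHE[2] (convexHull ℝ (f : Set E3))).toReal * u (center f, X.normal f) := by
  rw [varifold, integral_finsetSum_measure]
  · refine Finset.sum_congr rfl fun f _ => ?_
    rw [integral_smul_measure, integral_dirac, smul_eq_mul]
  · intro f hf
    exact (integrable_dirac' hu.stronglyMeasurable (by simp)).smul_measure (measure_face_lt_top hf).ne

/-- If the projection of the mesh is a bijection onto `S`, the area measure of `S` is the sum of
its restrictions to the projections of the faces. -/
lemma TriMesh.restrict_eq_sum {L : NNReal} (hc : ContinuousOn ξ X.space)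
    (hbij : Set.BijOn ξ X.space S)
    (hlip : ∀ f ∈ X.faces, LipschitzOnWith L ξ (convexHull ℝ (f : Set E3))) :
    (μHE[2].restrict S : Measure E3) =
      ∑ f ∈ X.faces, μHE[2].restrict (ξ '' convexHull ℝ (f : Set E3)) := by
  have hU : S = ⋃ f : X.faces, ξ '' convexHull ℝ ((f : Finset E3) : Set E3) := by
    rw [← hbij.image_eq, space, Set.image_iUnion₂, Set.iUnion_subtype]
  have hmeas : ∀ f : X.faces, MeasurableSet (ξ '' convexHull ℝ ((f : Finset E3) : Set E3)) :=
    fun f => ((((f : Finset E3).finite_toSet.isCompact_convexHull (𝕜 := ℝ))).image_of_continuousOn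
      (hc.mono (convexHull_subset_space f.2))).isClosed.measurableSet
  conv_lhs => rw [hU]
  rw [Measure.restrict_iUnion_ae _ fun f => (hmeas f).nullMeasurableSet, Measure.sum_fintype,
    Finset.sum_coe_sort X.faces
      (fun f => (μHE[2].restrict (ξ '' convexHull ℝ (f : Set E3)) : Measure E3))]
  -- Injectivity of ξ reduces overlaps of images to overlaps of faces, which lie in a common edge or
  -- vertex and are null.
  rintro ⟨f, hf⟩ ⟨g, hg⟩ hfg
  have hfg' : f ≠ g := fun h => hfg (Subtype.ext h)
  change μHE[2] (ξ '' convexHull ℝ (f : Set E3) ∩ ξ '' convexHull ℝ (g : Set E3)) = 0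
  rw [← hbij.injOn.image_inter (convexHull_subset_space hf) (convexHull_subset_space hg)]
  refine measure_mono_null (Set.image_mono (X.inter_subset f hf g hg)) ?_
  have h := euclideanHausdorffMeasure_image_le
    ((hlip f hf).mono (convexHull_mono (s := (f : Set E3) ∩ g) Set.inter_subset_left))
  rw [measure_inter_eq_zero hf hg hfg', mul_zero] at h
  exact le_antisymm h zero_le

theorem abs_integral_surfaceVarifold_sub_le (hS : IsCompact S) (hsm : IsSmoothSurface S)
    (hn : IsUnitNormalField S n) {u : E3 × S2 → ℝ} {k : ℝ} (hu : IsLip u k)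
    (hb : BddAbove (Set.range fun z => |u z|)) (hX : IsInscribed S n X)
    (hsmall : maxCurvature S n * X.maxEdge ≤ 1 / 100 * Real.sin X.minAngle) :
    |(∫ z, u z ∂(surfaceVarifold S n)) - ∫ z, u z ∂X.varifold| ≤
      150 * area S * ((maxCurvature S n + 1) / Real.sin X.minAngle) *
        (k + supNorm u) * X.maxEdge := by
  obtain ⟨hXS, ξ, hξ, hbij, hor⟩ := hX
  have hk : 0 ≤ k := hu.nonneg (n 0)
  have huc := hu.continuous hk
  have hκ := maxCurvature_nonneg S n
  have hη := X.maxEdge_nonneg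
  have hM : 0 ≤ supNorm u := (abs_nonneg _).trans (abs_le_supNorm hb (0, n 0))
  have hc := continuousOn_of_isClosestPoint_iff hS hξ
  have hP := fun f (hf : f ∈ X.faces) => TriMesh.isNearProjection hS hsm hn hXS hξ hsmall hf
  have hlip : ∀ f ∈ X.faces, LipschitzOnWith 2 ξ (convexHull ℝ (f : Set E3)) := fun f hf =>
    LipschitzOnWith.of_dist_le_mul fun y hy x hx => by
      rw [dist_eq_norm, dist_eq_norm]; exact (hP f hf).norm_sub_le hx hy
  have hsum := TriMesh.restrict_eq_sum hc hbij hlip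
  set κ := maxCurvature S n
  set s := Real.sin X.minAngle
  set ρ := κ * X.maxEdge / s with hρ
  have hpair : ContinuousOn (fun x => (x, n x)) S := continuousOn_id.prodMk hn.1
  have hcont : ContinuousOn (fun x => u (x, n x)) S := huc.comp_continuousOn hpair
  have hT : ∀ f ∈ X.faces, IsCompact (ξ '' convexHull ℝ (f : Set E3)) := fun f hf =>
    (f.finite_toSet.isCompact_convexHull (𝕜 := ℝ)).image_of_continuousOn
      (hc.mono (TriMesh.convexHull_subset_space hf))
  have hTS : ∀ f ∈ X.faces, ξ '' convexHull ℝ (f : Set E3) ⊆ S := fun f hf =>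
    (Set.image_mono (TriMesh.convexHull_subset_space hf)).trans hbij.image_eq.subset
  -- The sine is known to be positive only when a face exists: in an empty mesh the smallest angle
  -- defaults to 0. All estimates are therefore made per face.
  have hface : ∀ f ∈ X.faces, 0 < s ∧ ρ ≤ 1 / 100 ∧ κ * X.maxEdge ≤ ρ := by
    intro f hf
    have hs0 : 0 < s := TriMesh.sin_minAngle_pos hf
    refine ⟨hs0, ?_, le_div_self (by positivity) hs0 (Real.sin_le_one _)⟩
    rw [hρ, div_le_iff₀ hs0]; exact hsmall
  have harea : ∀ f ∈ X.faces, μHE[2] (ξ '' convexHull ℝ (f : Set E3)) < ⊤ ∧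
      |(μHE[2] (ξ '' convexHull ℝ (f : Set E3))).toReal -
        (μHE[2] (convexHull ℝ (f : Set E3))).toReal| ≤
        5 * (2 * (15 * ρ)) * (μHE[2] (ξ '' convexHull ℝ (f : Set E3))).toReal := by
    intro f hf
    obtain ⟨hs0, hρ1, hκη⟩ := hface f hf
    have hρ0 : 0 ≤ ρ := by positivity
    refine abs_measure_image_sub_le (by positivity) (by linarith) (TriMesh.measure_face_lt_top hf)
      fun x hx y hy => ?_
    exact (hP f hf).norm_sub_sub_sub_le (ν := X.normal f) (by linarith)
      (fun z hz w hw => TriMesh.inner_normal_sub hf hz hw)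
      (fun z hz => TriMesh.norm_normal_sub_le hS hsm hn hXS hξ hor hsmall hf hz) hx hy
  have hint : ∀ f ∈ X.faces,
      IntegrableOn (fun x => u (x, n x)) (ξ '' convexHull ℝ (f : Set E3)) μHE[2] := by
    intro f hf
    refine IntegrableOn.of_bound (harea f hf).1
      ((hcont.mono (hTS f hf)).aestronglyMeasurable (hT f hf).isClosed.measurableSet) (supNorm u) ?_
    exact Eventually.of_forall fun x => abs_le_supNorm hb _
  have hSint : ∫ z, u z ∂(surfaceVarifold S n) =
      ∑ f ∈ X.faces, ∫ x in ξ '' convexHull ℝ (f : Set E3), u (x, n x) ∂μHE[2] := by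
    rw [surfaceVarifold, integral_map
      (hpair.aemeasurable hS.isClosed.measurableSet) huc.aestronglyMeasurable, hsum, integral_finsetSum_measure hint]
  have hSarea : area S = ∑ f ∈ X.faces, (μHE[2] (ξ '' convexHull ℝ (f : Set E3))).toReal := by
    have := congrArg (fun m : Measure E3 => m Set.univ) hsum
    simp only [Measure.restrict_apply_univ, Measure.coe_finsetSum, Finset.sum_apply] at this
    rw [area, this, ENNReal.toReal_sum fun f hf => (harea f hf).1.ne]
  rw [hSint, TriMesh.integral_varifold huc, ← Finset.sum_sub_distrib]
  refine (Finset.abs_sum_le_sum_abs _ _).trans ?_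
  rw [hSarea, Finset.mul_sum, Finset.sum_mul, Finset.sum_mul, Finset.sum_mul]
  refine Finset.sum_le_sum fun f hf => ?_
  obtain ⟨hs0, hρ1, hκη⟩ := hface f hf
  have hρ0 : 0 ≤ ρ := by positivity
  have hηs : X.maxEdge ≤ X.maxEdge / s := le_div_self hη hs0 (Real.sin_le_one _)
  refine (abs_setIntegral_sub_le (harea f hf).1 (hint f hf)
    (B := k * (2 * X.maxEdge + 15 * ρ)) ?_ (abs_le_supNorm hb _) (by positivity)
    (harea f hf).2).trans ?_
  · rintro _ ⟨x, hx, rfl⟩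
    refine (hu _ _ _ _).trans ?_
    gcongr
    · have h1 := (hP f hf).dist_le x hx
      have h2 := TriMesh.dist_le_maxEdge_of_mem_convexHull hf hx (TriMesh.center_mem hf)
      have h3 := dist_triangle (ξ x) x (center f)
      rw [dist_comm (ξ x) x, dist_eq_norm x (ξ x)] at h3
      linarith
    · rw [Subtype.dist_eq, dist_eq_norm]
      exact TriMesh.norm_normal_sub_le hS hsm hn hXS hξ hor hsmall hf hx
  -- The shift of the base point costs η without curvature; this is the source of the +1 in κ + 1.
  · have hρη : ρ + X.maxEdge / s = (κ + 1) / s * X.maxEdge := by rw [hρ]; ring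
    have hE : 0 ≤ X.maxEdge / s := by positivity
    calc _ ≤ (μHE[2] (ξ '' convexHull ℝ (f : Set E3))).toReal *
          (k * (150 * (ρ + X.maxEdge / s)) + 150 * (ρ + X.maxEdge / s) * supNorm u) := by
          have h1 : 2 * X.maxEdge + 15 * ρ ≤ 150 * (ρ + X.maxEdge / s) := by linarith
          have h2 : 5 * (2 * (15 * ρ)) ≤ 150 * (ρ + X.maxEdge / s) := by linarith
          gcongr
      _ = _ := by rw [hρη]; ring

end

end MeshVarifold

theorem theorem1 :
    ∃ C : ℝ, 0 < C ∧ ∃ ε : ℝ, 0 < ε ∧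
      ∀ (S : Set E3) (n : E3 → S2),
        IsCompact S → IsSmoothSurface S → IsUnitNormalField S n →
      ∀ (u : E3 × S2 → ℝ) (k : ℝ),
        IsLip u k → BddAbove (Set.range fun z => |u z|) →
      (∀ X : TriMesh, IsInscribed S n X →
        maxCurvature S n * X.maxEdge ≤ ε * Real.sin X.minAngle →
        |(∫ z, u z ∂(surfaceVarifold S n)) - ∫ z, u z ∂X.varifold| ≤
          C * area S * ((maxCurvature S n + 1) / Real.sin X.minAngle) *
            (k + supNorm u) * X.maxEdge) ∧
      (∀ X Y : TriMesh, IsInscribed S n X → IsInscribed S n Y →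
        maxCurvature S n * X.maxEdge ≤ ε * Real.sin X.minAngle →
        maxCurvature S n * Y.maxEdge ≤ ε * Real.sin Y.minAngle →
        |(∫ z, u z ∂X.varifold) - ∫ z, u z ∂Y.varifold| ≤
          C * area S * (maxCurvature S n + 1) * (k + supNorm u) *
            (X.maxEdge / Real.sin X.minAngle + Y.maxEdge / Real.sin Y.minAngle)) := by
  refine ⟨150, by norm_num, 1 / 100, by norm_num, fun S n hS hsm hn u k hu hb => ?_⟩
  refine ⟨fun X hX hsmall => abs_integral_surfaceVarifold_sub_le hS hsm hn hu hb hX hsmall,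
    fun X Y hX hY hsX hsY => ?_⟩
  have h1 := abs_integral_surfaceVarifold_sub_le hS hsm hn hu hb hX hsX
  have h2 := abs_integral_surfaceVarifold_sub_le hS hsm hn hu hb hY hsY
  have h3 := abs_sub_le (∫ z, u z ∂X.varifold) (∫ z, u z ∂(surfaceVarifold S n))
    (∫ z, u z ∂Y.varifold)
  rw [abs_sub_comm] at h1
  refine h3.trans ((add_le_add h1 h2).trans_eq ?_)
  ring
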